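/- **Setting.** A *Sumcheck instance* $(G,F,q,a)$ consists of a connected graph $G$ on $n\ge 1$ nodes with identifiers $0,\dots,n-1$, together with a spanning tree of $G$ rooted at node $0$ (every other node knows the identifier of its parent), a prime $q$, a polynomial $F\in\mathbb F_q[x_1,\dots,x_N]$ with $N\ge 1$ and of degree at most $d$ in each variable, and a value $a\in\mathbb F_q$. The numbers $n,N,d,q$ and a security parameter $t\ge 1$ are public. Initially a node knows, in addition, $a$, its own identifier, those of its neighbours and that of its parent; it can access $F$ only through an evaluation oracle. In a *distributed interactive proof* the nodes, using private coins, and an unbounded prover first exchange messages in alternating rounds, the last of which is the prover's: in a prover round the prover sends a message to every node, in a verifier round every node sends a message to the prover. Afterwards the nodes, without the prover, run a distributed verification algorithm in which each node finally accepts or rejects. $\mathcal C[R,B]$ denotes the randomized synchronous distributed algorithms with at most $R$ communication rounds and at most $B$ bits per edge, direction and round. The *view* of a node consists of its coins, all messages it exchanges with the prover, and all messages of neighbours and oracle answers it receives during the verification. A *simulator* is a distributed algorithm without a prover (but with the oracle for $F$) that outputs a view at each node. **Theorem (Distributed ZK Sumcheck).** There are a distributed interactive proof $\Pi$ and a simulator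 $S$, both depending only on the public parameters $n,N,d,t,q$, an honest (randomized) prover for each instance, and a function $\varepsilon$ that is negligible in $n$ (i.e. $n^k\varepsilon(n)\to 0$ for every $k$) such that the following holds for all $n,N,t\ge 1$, all $d$, all primes $q$ and all Sumcheck instances $(G,F,q,a)$ with these parameters. * **Completeness.** If $\sum_{x\in\{0,1\}^N}F(x)=a$, then with the honest prover all nodes accept with probability $1$. * **Soundness.** If $\sum_{x\in\{0,1\}^N}F(x)\ne a$, then for every prover the probability that all nodes accept is at most $\frac{Nd}{q}+\frac1t$. * **Statistical zero-knowledge.** If $\sum_{x\in\{0,1\}^N}F(x)=a$, then for every node $v$ the total variation distance between the output of $S$ at $v$ and the view of $v$ in the execution of $\Pi$ with the honest prover is at most $\varepsilon(n)$. * **Complexity.** $\Pi$ has $O(N)$ rounds of interaction. If $t$ is fixed and $d=O(n)$, each message between the prover and a node has $O(\log q)$ bits, and the verification algorithm and the simulator belong to $\mathcal C[O(1),O(N\log q)]$. The constants for the numbers of rounds are absolute; those for the message sizes depend only on $t$ and on the constant in $d=O(n)$. In every execution, with any prover, the nodes together make at most one oracle query to $F$ in the verification, and also at most one in every run of the simulator.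 -/

import Mathlib

namespace DistSumcheck

/-! ### Probability over finite uniform coins -/

/-- The probability of the event `E` when `ω` is uniform in the finite type `Ω`. -/
noncomputable def prob {Ω : Type} [Fintype Ω] (E : Set Ω) : ℝ :=
  (E.ncard : ℝ) / (Fintype.card Ω : ℝ)

/-- Total variation distance `sup_A |Pr[X ∈ A] - Pr[Y ∈ A]|` between the distributions of two
random variables on (different) finite uniform probability spaces. -/
noncomputable def tvDist {Ω Ω' α : Type} [Fintype Ω] [Fintype Ω'] (X : Ω → α) (Y : Ω' → α) : ℝ :=
  ⨆ A : Set α, |prob {ω | X ω ∈ A} - prob {ω | Y ω ∈ A}|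

/-! ### Sumcheck instances -/

/-- A message of exactly `ℓ` bits. -/
abbrev Msg (ℓ : ℕ) : Type := Fin ℓ → Bool

/-- A Sumcheck instance `(G, F, q, a)`: a connected graph whose `n` nodes are their identifiers
`0, …, n - 1`, a spanning tree of it rooted at the node `0` and given by parent pointers,
an `N`-variate polynomial over `𝔽_q` of individual degree at most `d`, and the claimed sum. -/
structure SumcheckInstance (n N d q : ℕ) [NeZero n] where
  graph : SimpleGraph (Fin n)
  connected : graph.Connected
  parent : Fin n → Option (Fin n)
  parent_eq_none_iff : ∀ v, parent v = none ↔ v = 0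
  parent_adj : ∀ v u, parent v = some u → graph.Adj v u
  reaches_root : ∀ v, Relation.ReflTransGen (fun x y => parent x = some y) v 0
  poly : MvPolynomial (Fin N) (ZMod q)
  degreeOf_le : ∀ i, poly.degreeOf i ≤ d
  target : ZMod q

/-- What a node knows at the start besides the public parameters: its identifier, the identifiers
of its neighbours, the identifier of its parent in the tree (if any) and the claimed sum `a`. -/
structure LocalInput (n q : ℕ) where
  id : Fin n
  nbrs : Set (Fin n)
  parent : Option (Fin n)
  target : ZMod q

namespace SumcheckInstance

variable {n N d q : ℕ} [NeZero n]

def localInput (I : SumcheckInstance n N d q) (v : Fin n) : LocalInput n q where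
  id := v
  nbrs := I.graph.neighborSet v
  parent := I.parent v
  target := I.target

/-- The evaluation oracle for the polynomial. -/
noncomputable def oracle (I : SumcheckInstance n N d q) (x : Fin N → ZMod q) : ZMod q :=
  MvPolynomial.eval x I.poly

/-- The claim `∑_{x ∈ {0,1}^N} F(x) = a`. -/
def Claim (I : SumcheckInstance n N d q) : Prop :=
  ∑ x : Fin N → Bool, I.oracle (fun i => if x i then 1 else 0) = I.target

end SumcheckInstance

/-! ### Synchronous distributed algorithms with an evaluation oracle -/

/-- What a node has received while a distributed algorithm runs: the answers to its oracle queries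
(one optional query per stage) and, for each past round, the messages of its neighbours
(`none` for a node that is not a neighbour). -/
structure LocalHist (n q B : ℕ) where
  answers : List (Option (ZMod q))
  inbox : List (Fin n → Option (Msg B))

/-- A randomized distributed algorithm on `n` nodes with private inputs in `In` and outputs in
`Out`, which runs in `rounds` synchronous rounds with messages of `bits` bits on every edge in each
direction. Before each round, and before the output, a node may query the oracle. All local
functions depend only on the input, the coins and the history of the node itself. -/
structure DistAlg (n N q : ℕ) (In Out : Type) where
  rounds : ℕ
  bits : ℕ
  Coin : Type
  [coinFintype : Fintype Coin]
  [coinNonempty : Nonempty Coin]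
  query : In → Coin → LocalHist n q bits → Option (Fin N → ZMod q)
  /-- the message to the given neighbour -/
  send : In → Coin → LocalHist n q bits → Fin n → Msg bits
  output : In → Coin → LocalHist n q bits → Out

attribute [instance] DistAlg.coinFintype DistAlg.coinNonempty

namespace DistAlg

variable {n N q : ℕ} {In Out : Type}

/-- The history of a node after its (optional) query at the current stage. -/
def ask (A : DistAlg n N q In Out) (O : (Fin N → ZMod q) → ZMod q) (x : In) (c : A.Coin)
    (h : LocalHist n q A.bits) : LocalHist n q A.bits :=
  { h with answers := h.answers ++ [(A.query x c h).map O] }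

open Classical in
/-- The histories of all nodes after `s` rounds on the graph `G`. -/
noncomputable def hist (A : DistAlg n N q In Out) (G : SimpleGraph (Fin n))
    (O : (Fin N → ZMod q) → ZMod q) (x : Fin n → In) (c : Fin n → A.Coin) :
    ℕ → Fin n → LocalHist n q A.bits
  | 0 => fun _ => ⟨[], []⟩
  | s + 1 => fun v =>
      let h : Fin n → LocalHist n q A.bits := fun u => A.ask O (x u) (c u) (hist A G O x c s u)
      { h v with
        inbox := (h v).inbox ++
          [fun u => if G.Adj u v then some (A.send (x u) (c u) (h u) v) else none] }

/-- The history of a node at the end, after its last optional query. -/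
noncomputable def finalHist (A : DistAlg n N q In Out) (G : SimpleGraph (Fin n))
    (O : (Fin N → ZMod q) → ZMod q) (x : Fin n → In) (c : Fin n → A.Coin) (v : Fin n) :
    LocalHist n q A.bits :=
  A.ask O (x v) (c v) (A.hist G O x c A.rounds v)

noncomputable def out (A : DistAlg n N q In Out) (G : SimpleGraph (Fin n))
    (O : (Fin N → ZMod q) → ZMod q) (x : Fin n → In) (c : Fin n → A.Coin) (v : Fin n) : Out :=
  A.output (x v) (c v) (A.finalHist G O x c v)

/-- The number of oracle queries made by all nodes together. -/
noncomputable def queryCount (A : DistAlg n N q In Out) (G : SimpleGraph (Fin n))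
    (O : (Fin N → ZMod q) → ZMod q) (x : Fin n → In) (c : Fin n → A.Coin) : ℕ :=
  ∑ v, (A.finalHist G O x c v).answers.reduceOption.length

end DistAlg

/-! ### Distributed interactive proofs -/

/-- A (possibly randomized) prover. In its rounds it sends each node a message, which may depend on
everything that was exchanged with all nodes so far. -/
structure Prover (n ℓ : ℕ) where
  Coin : Type
  [coinFintype : Fintype Coin]
  [coinNonempty : Nonempty Coin]
  msg : Coin → List (Fin n → Msg ℓ) → Fin n → Msg ℓ

attribute [instance] Prover.coinFintype Prover.coinNonempty

/-- The verifier's side of a distributed interactive proof: `rounds` alternating rounds of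
interaction with messages of `bits` bits between the prover and each node, the last one being the
prover's, and then a distributed verification algorithm without the prover. -/
structure DIP (n N q : ℕ) where
  rounds : ℕ
  bits : ℕ
  Coin : Type
  [coinFintype : Fintype Coin]
  [coinNonempty : Nonempty Coin]
  /-- the message of a node to the prover, given what it exchanged with the prover so far -/
  nodeMsg : LocalInput n q → Coin → List (Msg bits) → Msg bits
  verifier : DistAlg n N q (LocalInput n q × Coin × List (Msg bits)) Bool

attribute [instance] DIP.coinFintype DIP.coinNonempty

/-- The view of a node: its coins, all messages exchanged with the prover, and all messages
of neighbours and oracle answers received during the verification. -/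
structure NodeView {n N q : ℕ} (p : DIP n N q) where
  coin : p.Coin
  proverMsgs : List (Msg p.bits)
  verifierCoin : p.verifier.Coin
  received : LocalHist n q p.verifier.bits

/-- A simulator: a distributed algorithm without a prover that outputs a view at each node. -/
abbrev Simulator {n N q : ℕ} (p : DIP n N q) : Type 1 :=
  DistAlg n N q (LocalInput n q) (NodeView p)

namespace DIP

variable {n N d q : ℕ} [NeZero n]

/-- All coins of an execution: those of the nodes in the interaction and in the verification,
and those of the prover. -/
abbrev Coins (p : DIP n N q) (P : Prover n p.bits) : Type :=
  (Fin n → p.Coin) × (Fin n → p.verifier.Coin) × P.Coin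

/-- The messages exchanged between the prover and the nodes in the first `i` rounds (numbered from
`0`). Round `i` belongs to the prover if `rounds - i` is odd, so the rounds alternate and
the last one is the prover's. -/
def transcript (p : DIP n N q) (P : Prover n p.bits) (I : SumcheckInstance n N d q)
    (ω : p.Coins P) : ℕ → List (Fin n → Msg p.bits)
  | 0 => []
  | i + 1 =>
      let τ := transcript p P I ω i
      τ ++ [if Odd (p.rounds - i) then P.msg ω.2.2 τ
            else fun v => p.nodeMsg (I.localInput v) (ω.1 v) (τ.map (fun m => m v))]

/-- The messages exchanged between the prover and the node `v` during the whole interaction. -/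
def nodeTranscript (p : DIP n N q) (P : Prover n p.bits) (I : SumcheckInstance n N d q)
    (ω : p.Coins P) (v : Fin n) : List (Msg p.bits) :=
  (p.transcript P I ω p.rounds).map (fun m => m v)

/-- The input of the node `v` to the verification algorithm. -/
def verifierInput (p : DIP n N q) (P : Prover n p.bits) (I : SumcheckInstance n N d q)
    (ω : p.Coins P) (v : Fin n) : LocalInput n q × p.Coin × List (Msg p.bits) :=
  (I.localInput v, ω.1 v, p.nodeTranscript P I ω v)

/-- All nodes accept. -/
def Accepts (p : DIP n N q) (P : Prover n p.bits) (I : SumcheckInstance n N d q)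
    (ω : p.Coins P) : Prop :=
  ∀ v, p.verifier.out I.graph I.oracle (p.verifierInput P I ω) ω.2.1 v = true

noncomputable def acceptProb (p : DIP n N q) (P : Prover n p.bits)
    (I : SumcheckInstance n N d q) : ℝ :=
  prob {ω : p.Coins P | p.Accepts P I ω}

noncomputable def view (p : DIP n N q) (P : Prover n p.bits) (I : SumcheckInstance n N d q)
    (v : Fin n) (ω : p.Coins P) : NodeView p where
  coin := ω.1 v
  proverMsgs := p.nodeTranscript P I ω v
  verifierCoin := ω.2.1 v
  received := p.verifier.finalHist I.graph I.oracle (p.verifierInput P I ω) ω.2.1 v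

/-- The number of oracle queries of all nodes together in an execution. -/
noncomputable def queryCount (p : DIP n N q) (P : Prover n p.bits)
    (I : SumcheckInstance n N d q) (ω : p.Coins P) : ℕ :=
  p.verifier.queryCount I.graph I.oracle (p.verifierInput P I ω) ω.2.1

/-- The view of the node `v` that the simulator produces from the local inputs. -/
noncomputable def simView {p : DIP n N q} (S : Simulator p) (I : SumcheckInstance n N d q)
    (v : Fin n) (c : Fin n → S.Coin) : NodeView p :=
  S.out I.graph I.oracle I.localInput c v

/-- The number of oracle queries of all nodes together in a run of the simulator. -/
noncomputable def simQueryCount {p : DIP n N q} (S : Simulator p) (I : SumcheckInstance n N d q)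
    (c : Fin n → S.Coin) : ℕ :=
  S.queryCount I.graph I.oracle I.localInput c

end DIP

end DistSumcheck

open DistSumcheck

/-!
In each round of the sumcheck protocol the prover shares the coefficients of the round polynomial
additively, each between the node in charge of it and the cyclic successor of that node. The checks
of the verifier are linear in these polynomials, so every node evaluates them on its shares and adds
a mask, and the results are summed up along the tree to the root. The masks of a check have to sum
to zero; the root enforces this by `t` random linear tests, which are blinded and summed up along
the tree in the same way.

If the claim is false and all masks sum to zero, the difference between the polynomials of the
prover and the correct ones satisfies the sumcheck equations with a nonzero sum and the value zero
at the end, so some nonzero difference vanishes at its challenge; this has probability at most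
`N * d / q`. The first nonzero sum of masks is committed to before the coefficients of its tests
are drawn, and passes all of them with probability at most `1 / q ^ t ≤ 1 / t`.

For the zero-knowledge property, a node sees only one share of each coefficient and blinded sums
over subtrees. These are uniform, apart from the sums at the root, which are determined by the
claimed sum and the single oracle answer; and the rest of what the prover sends to the node is
determined by its test.
-/

namespace DistSumcheck

open Function Polynomial Matrix
open scoped BigOperators

noncomputable section

/-! ### Finite uniform probability -/

section Probability

variable {Ω Ω' : Type} [Fintype Ω] [Fintype Ω']

theorem prob_eq_expect (E : Set Ω) : prob E = 𝔼 ω, E.indicator 1 ω := by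
  classical
  simp [prob, Fintype.expect_eq_sum_div_card, Set.indicator_apply, Set.ncard_eq_toFinset_card']

theorem prob_nonneg (E : Set Ω) : 0 ≤ prob E := by
  unfold prob
  positivity

theorem prob_mono {E E' : Set Ω} (h : E ⊆ E') : prob E ≤ prob E' := by
  unfold prob
  gcongr
  exact Set.toFinite E'

theorem prob_univ [Nonempty Ω] : prob (Set.univ : Set Ω) = 1 := by
  simp [prob]

theorem prob_le_one [Nonempty Ω] (E : Set Ω) : prob E ≤ 1 :=
  (prob_mono (Set.subset_univ E)).trans_eq prob_univ

theorem prob_union_le (E E' : Set Ω) : prob (E ∪ E') ≤ prob E + prob E' := by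
  unfold prob
  rw [← add_div]
  gcongr
  exact_mod_cast Set.ncard_union_le E E'

theorem prob_iUnion_le {κ : Type} [Fintype κ] (E : κ → Set Ω) :
    prob (⋃ k, E k) ≤ ∑ k, prob (E k) := by
  simp only [prob, ← Finset.sum_div]
  gcongr
  exact_mod_cast (by simpa using Finset.set_ncard_biUnion_le Finset.univ E :
    (⋃ k, E k).ncard ≤ ∑ k, (E k).ncard)

theorem prob_iUnion {κ : Type} [Fintype κ] {E : κ → Set Ω} (hE : Pairwise (Disjoint on E)) :
    prob (⋃ k, E k) = ∑ k, prob (E k) := by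
  simp only [prob, ← Finset.sum_div]
  rw [Set.ncard_iUnion_of_finite (fun k => Set.toFinite (E k)) hE, finsum_eq_sum_of_fintype,
    Nat.cast_sum]

theorem prob_preimage_of_bijective {f : Ω → Ω'} (hf : Bijective f) (E : Set Ω') :
    prob (f ⁻¹' E) = prob E := by
  simp only [prob_eq_expect]
  exact Fintype.expect_bijective f hf _ _ fun _ => rfl

theorem prob_eq_expect_prob_fst (E : Set (Ω × Ω')) :
    prob E = 𝔼 y, prob {x | (x, y) ∈ E} := by
  simp only [prob_eq_expect]
  rw [Finset.expect_comm, ← Finset.univ_product_univ, Finset.expect_product]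
  rfl

theorem prob_le_of_forall_prob_fst_le [Nonempty Ω'] {E : Set (Ω × Ω')} {b : ℝ}
    (h : ∀ y, prob {x | (x, y) ∈ E} ≤ b) : prob E ≤ b := by
  rw [prob_eq_expect_prob_fst]
  exact (Finset.expect_le_expect fun y _ => h y).trans_eq (Fintype.expect_const b)

theorem prob_preimage_fst [Nonempty Ω'] (E : Set Ω) :
    prob (Prod.fst ⁻¹' E : Set (Ω × Ω')) = prob E := by
  rw [prob_eq_expect_prob_fst]
  exact Fintype.expect_const (prob E)

section Resampling

variable {ι X : Type} [Fintype ι] [DecidableEq ι] [Fintype X] [Nonempty X]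

theorem prob_eq_expect_prob_update (i : ι) (E : Set (ι → X)) :
    prob E = 𝔼 c, prob {x | update c i x ∈ E} := by
  let swap (p : X × (ι → X)) : (ι → X) × X := (update p.2 i p.1, p.2 i)
  have hswap : Bijective swap :=
    bijective_iff_has_inverse.2 ⟨fun p => (p.1 i, update p.1 i p.2), fun p => by simp [swap],
      fun p => by simp [swap]⟩
  rw [← prob_preimage_fst (Ω' := X) E, ← prob_preimage_of_bijective hswap,
    prob_eq_expect_prob_fst]
  rfl

theorem prob_preimage_eval (i : ι) (E : Set X) :
    prob (Function.eval i ⁻¹' E : Set (ι → X)) = prob E := by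
  rw [prob_eq_expect_prob_update i]
  simp only [Set.mem_preimage, Function.eval, update_self]
  exact Fintype.expect_const (prob E)

theorem prob_le_of_forall_prob_update_le (i : ι) {E : Set (ι → X)} {b : ℝ}
    (h : ∀ c, prob {x | update c i x ∈ E} ≤ b) : prob E ≤ b := by
  rw [prob_eq_expect_prob_update i]
  exact (Finset.expect_le_expect fun c _ => h c).trans_eq (Fintype.expect_const b)

theorem prob_and_apply_mem_le (i : ι) {D : Set (ι → X)} {T : (ι → X) → Set X} {b : ℝ}
    (hD : DependsOn (· ∈ D) {i}ᶜ) (hT : DependsOn T {i}ᶜ) (hb : ∀ c ∈ D, prob (T c) ≤ b) :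
    prob {c | c ∈ D ∧ c i ∈ T c} ≤ prob D * b := by
  have hupdate (c : ι → X) (x : X) : ∀ j ∈ ({i}ᶜ : Set ι), update c i x j = c j :=
    fun j hj => update_of_ne hj x c
  have hcond (c : ι → X) :
      prob {x | update c i x ∈ D ∧ update c i x i ∈ T (update c i x)} ≤
        D.indicator 1 c * b := by
    simp only [(hD (hupdate c _)).to_iff, hT (hupdate c _), update_self]
    by_cases hc : c ∈ D
    · simpa [hc] using hb c hc
    · simp [hc, prob]
  rw [prob_eq_expect_prob_update i, prob_eq_expect D, Finset.expect_mul]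
  exact Finset.expect_le_expect fun c _ => hcond c

end Resampling

variable {α : Type}

theorem tvDist_le_one [Nonempty Ω] [Nonempty Ω'] (X : Ω → α) (Y : Ω' → α) :
    tvDist X Y ≤ 1 :=
  ciSup_le fun _ =>
    abs_sub_le_of_nonneg_of_le (prob_nonneg _) (prob_le_one _) (prob_nonneg _) (prob_le_one _)

theorem tvDist_eq_zero {X : Ω → α} {Y : Ω' → α}
    (h : ∀ A : Set α, prob (X ⁻¹' A) = prob (Y ⁻¹' A)) : tvDist X Y = 0 := by
  simp only [Set.preimage] at h
  simp [tvDist, h]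

end Probability

/-! ### Bit encodings -/

section Encoding

variable {α : Type}

open Classical in
/-- A fixed encoding of `α` by `b`-bit messages, injective as soon as `α` has at most `2 ^ b`
elements. -/
def encode (b : ℕ) : α → Msg b :=
  if h : Nonempty (α ↪ Msg b) then h.some else fun _ _ => false

/-- The decoding that belongs to `encode`; messages that encode nothing decode arbitrarily. -/
def decode [Nonempty α] {b : ℕ} : Msg b → α :=
  invFun (encode b)

theorem decode_encode [Fintype α] [Nonempty α] {b : ℕ} (h : Fintype.card α ≤ 2 ^ b) (a : α) :
    decode (encode b a) = a := by
  have hemb : Nonempty (α ↪ Msg b) := by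
    simpa [Embedding.nonempty_iff_card_le] using h
  have hinj : Injective (encode b : α → Msg b) := by
    rw [encode, dif_pos hemb]
    exact hemb.some.injective
  exact leftInverse_invFun hinj a

end Encoding

/-! ### Sums along rooted trees -/

/-- The parent pointers `parent` form a tree with the given root. -/
structure IsRootedTree {ι : Type*} (parent : ι → Option ι) (root : ι) : Prop where
  parent_eq_none_iff : ∀ v, parent v = none ↔ v = root
  reaches_root : ∀ v, Relation.ReflTransGen (fun x y => parent x = some y) v root

theorem SumcheckInstance.isRootedTree {n N d q : ℕ} [NeZero n] (I : SumcheckInstance n N d q) :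
    IsRootedTree I.parent 0 :=
  ⟨I.parent_eq_none_iff, I.reaches_root⟩

theorem IsRootedTree.apply_eq_apply_root {ι β : Type*} {parent : ι → Option ι}
    {root : ι} (h : IsRootedTree parent root) {x : ι → β}
    (hx : ∀ u v, parent u = some v → x u = x v) (v : ι) : x v = x root :=
  Relation.ReflTransGen.head_induction_on (h.reaches_root v) rfl
    fun huv _ ih => (hx _ _ huv).trans ih

section Tree

variable {ι : Type*} {K : Type*} [Fintype ι] [DecidableEq ι] [Field K] {parent : ι → Option ι}
  {root : ι}

variable (K parent) in
/-- The matrix that takes from the value at each node the values at its children. For a rooted tree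
its inverse maps `x` to the family of the sums of `x` over the subtrees. -/
def treeMatrix : Matrix ι ι K :=
  1 - Matrix.of fun v u => if parent u = some v then 1 else 0

theorem treeMatrix_mulVec_apply (s : ι → K) (v : ι) :
    (treeMatrix K parent *ᵥ s) v = s v - ∑ u, if parent u = some v then s u else 0 := by
  rw [treeMatrix, sub_mulVec, one_mulVec]
  simp [mulVec, dotProduct]

theorem vecMul_treeMatrix_apply (x : ι → K) (u : ι) :
    (x ᵥ* treeMatrix K parent) u = x u - (parent u).elim 0 x := by
  rw [treeMatrix, vecMul_sub, vecMul_one]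
  cases h : parent u <;> simp [vecMul, dotProduct, h]

theorem IsRootedTree.isUnit_treeMatrix (h : IsRootedTree parent root) :
    IsUnit (treeMatrix K parent) := by
  rw [← vecMul_injective_iff_isUnit, ← coe_vecMulLinear, injective_iff_map_eq_zero]
  intro x hx
  have hparent (u : ι) : x u = (parent u).elim 0 x :=
    sub_eq_zero.1 ((vecMul_treeMatrix_apply x u).symm.trans (congrFun hx u))
  have hroot : x root = 0 := by
    rw [hparent, (h.parent_eq_none_iff root).2 rfl, Option.elim_none]
  funext v
  exact (h.apply_eq_apply_root (fun u v huv => by rw [hparent, huv, Option.elim_some]) v).trans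
    hroot

theorem IsRootedTree.sum_treeMatrix_mulVec (h : IsRootedTree parent root) (s : ι → K) :
    ∑ v, (treeMatrix K parent *ᵥ s) v = s root := by
  have hone : (1 : ι → K) ᵥ* treeMatrix K parent = Pi.single root 1 := by
    funext u
    rw [vecMul_treeMatrix_apply]
    rcases eq_or_ne u root with rfl | hu
    · simp [(h.parent_eq_none_iff u).2 rfl]
    · obtain ⟨v, hv⟩ := Option.ne_none_iff_exists'.1 (mt (h.parent_eq_none_iff u).1 hu)
      simp [hv, hu]
  rw [← one_dotProduct, dotProduct_mulVec, hone, single_one_dotProduct]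

end Tree

/-! ### The sumcheck polynomials -/

section CubeSum

variable {K A : Type*} [Field K] [CommRing A] [Algebra K A] {N : ℕ}

/-- The sum of the values of `F` over all ways to set the variables in `u` to `0` or `1`, the other
variables being set by `r`; a subset `s` of `u` stands for the point that is `1` exactly on `s`. -/
def cubeSum (F : MvPolynomial (Fin N) K) (u : Finset (Fin N)) (r : Fin N → A) : A :=
  ∑ s ∈ u.powerset, MvPolynomial.aeval (u.piecewise (s.piecewise 1 0) r) F

variable (F : MvPolynomial (Fin N) K)

theorem cubeSum_univ (r : Fin N → A) :
    cubeSum F Finset.univ r =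
      ∑ x : Fin N → Bool, MvPolynomial.aeval (fun i => if x i then (1 : A) else 0) F := by
  have hbij : Bijective fun (s : Finset (Fin N)) i => decide (i ∈ s) :=
    bijective_iff_has_inverse.2 ⟨fun x => {i | x i = true}, fun s => by simp, fun x => by simp⟩
  rw [cubeSum, Finset.powerset_univ]
  refine Fintype.sum_bijective _ hbij _ _ fun s => ?_
  congr 2
  funext i
  simp [Finset.piecewise]

theorem cubeSum_empty (r : Fin N → A) : cubeSum F ∅ r = MvPolynomial.aeval r F := by
  simp [cubeSum]

theorem cubeSum_insert {u : Finset (Fin N)} {i : Fin N} (hi : i ∉ u) (r : Fin N → A) :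
    cubeSum F (insert i u) r = cubeSum F u (update r i 0) + cubeSum F u (update r i 1) := by
  rw [cubeSum, Finset.sum_powerset_insert hi, cubeSum, cubeSum]
  congr 1 <;> refine Finset.sum_congr rfl fun s hs => ?_
  · have his : i ∉ s := fun h => hi (Finset.mem_powerset.1 hs h)
    rw [Finset.piecewise_insert, Finset.update_piecewise_of_notMem _ _ _ hi,
      Finset.piecewise_eq_of_notMem _ _ _ his, Pi.zero_apply]
  · rw [Finset.piecewise_insert, Finset.update_piecewise_of_notMem _ _ _ hi,
      Finset.piecewise_eq_of_mem _ _ _ (Finset.mem_insert_self i s), Pi.one_apply]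
    congr 2
    refine Finset.piecewise_congr _ (fun j hj => ?_) fun _ _ => rfl
    exact Finset.piecewise_insert_of_ne _ _ _ (ne_of_mem_of_not_mem hj hi)

theorem map_cubeSum {B : Type*} [CommRing B] [Algebra K B] (f : A →ₐ[K] B)
    (u : Finset (Fin N)) (r : Fin N → A) : f (cubeSum F u r) = cubeSum F u (f ∘ r) := by
  rw [cubeSum, map_sum, cubeSum]
  refine Finset.sum_congr rfl fun s _ => ?_
  rw [MvPolynomial.comp_aeval_apply]
  congr 2
  funext i
  by_cases hu : i ∈ u <;> by_cases hs : i ∈ s <;> simp [hu, hs]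

theorem cubeSum_congr {u : Finset (Fin N)} {r r' : Fin N → A} (h : ∀ i ∉ u, r i = r' i) :
    cubeSum F u r = cubeSum F u r' := by
  refine Finset.sum_congr rfl fun s _ => ?_
  rw [Finset.piecewise_congr _ (fun _ _ => rfl) h]

end CubeSum

section RoundPoly

variable {K : Type*} [Field K] {N d : ℕ} (F : MvPolynomial (Fin N) K)

theorem natDegree_aeval_le {i : Fin N} {y : Fin N → K[X]} (hi : (y i).natDegree ≤ 1)
    (hy : ∀ j ≠ i, (y j).natDegree = 0) :
    (MvPolynomial.aeval y F).natDegree ≤ F.degreeOf i := by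
  rw [MvPolynomial.aeval_eq_eval₂Hom, MvPolynomial.coe_eval₂Hom, MvPolynomial.eval₂_eq']
  refine natDegree_sum_le_of_forall_le _ _ fun m hm => ?_
  calc (C (F.coeff m) * ∏ j, y j ^ m j).natDegree
      ≤ ∑ j, (y j ^ m j).natDegree :=
        (natDegree_C_mul_le _ _).trans (natDegree_prod_le _ _)
    _ = (y i ^ m i).natDegree := Fintype.sum_eq_single i fun j hj =>
        Nat.le_zero.1 (natDegree_pow_le.trans (by simp [hy j hj]))
    _ ≤ m i := natDegree_pow_le.trans (by nlinarith)
    _ ≤ F.degreeOf i := MvPolynomial.monomial_le_degreeOf i hm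

/-- The polynomial that the honest prover of the sumcheck protocol sends in round `i`, given
the challenges `r` of the rounds before. -/
def roundPoly (r : Fin N → K) (i : Fin N) : K[X] :=
  cubeSum F (Finset.Ioi i) (update (C ∘ r) i X)

theorem natDegree_roundPoly_le (hF : ∀ i, F.degreeOf i ≤ d) (r : Fin N → K) (i : Fin N) :
    (roundPoly F r i).natDegree ≤ d := by
  refine natDegree_sum_le_of_forall_le _ _ fun s _ =>
    (natDegree_aeval_le F (i := i) ?_ fun j hj => ?_).trans (hF i)
  · simp
  · by_cases hij : i < j <;> by_cases hjs : j ∈ s <;> simp [hij, hjs, hj]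

theorem eval_roundPoly (r : Fin N → K) (i : Fin N) (a : K) :
    (roundPoly F r i).eval a = cubeSum F (Finset.Ioi i) (update r i a) := by
  rw [roundPoly, ← coe_aeval_eq_eval, map_cubeSum]
  congr 1
  funext j
  rcases eq_or_ne j i with rfl | hj <;> simp [*]

theorem dependsOn_roundPoly (i : Fin N) : DependsOn (roundPoly F · i) (Set.Iio i) := by
  refine fun r r' h => cubeSum_congr F fun j hj => ?_
  rcases (not_lt.1 (mt Finset.mem_Ioi.2 hj)).eq_or_lt with rfl | hji
  · simp
  · simp [hji.ne, h j hji]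

end RoundPoly

/-! ### The sumcheck equations -/

section CheckForm

variable {K : Type*} [Field K] {N : ℕ}

/-- The linear form of the `i`-th check on the polynomials of the rounds, for the challenges `r`:
the sum of the values of the `i`-th polynomial at `0` and `1` minus the value of the previous one
at its challenge. The first and the last check lack one of the two terms. -/
def checkForm (r : Fin N → K) (i : Fin (N + 1)) : (Fin N → K[X]) →ₗ[K] K :=
  (Fin.snoc (fun j => (leval 0 + leval 1) ∘ₗ LinearMap.proj j) 0 :
    Fin (N + 1) → (Fin N → K[X]) →ₗ[K] K) i -
  (Fin.cons 0 fun j => leval (r j) ∘ₗ LinearMap.proj j :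
    Fin (N + 1) → (Fin N → K[X]) →ₗ[K] K) i

/-- The value that `checkForm` should have when the sum is claimed to be `a` and the polynomial
takes the value `b` at the point of the challenges. -/
def checkTarget (N : ℕ) (a b : K) : Fin (N + 1) → K :=
  Pi.single 0 a - Pi.single (Fin.last N) b

theorem checkForm_eq_checkTarget_iff {r : Fin N → K} {a b : K} {P : Fin N → K[X]}
    {i : Fin (N + 1)} :
    checkForm r i P = checkTarget N a b i ↔
      (Fin.snoc (fun j => (P j).eval 0 + (P j).eval 1) b : Fin (N + 1) → K) i =
        (Fin.cons a fun j => (P j).eval (r j) : Fin (N + 1) → K) i := by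
  have hsnoc : (Fin.snoc (fun j => (P j).eval 0 + (P j).eval 1) b : Fin (N + 1) → K) i =
      (Fin.snoc (fun j => (leval 0 + leval 1) ∘ₗ LinearMap.proj j) 0 :
        Fin (N + 1) → (Fin N → K[X]) →ₗ[K] K) i P + (Pi.single (Fin.last N) b : _ → K) i := by
    cases i using Fin.lastCases <;> simp [leval]
  have hcons : (Fin.cons a fun j => (P j).eval (r j) : Fin (N + 1) → K) i =
      (Pi.single 0 a : _ → K) i + (Fin.cons 0 fun j => leval (r j) ∘ₗ LinearMap.proj j :
        Fin (N + 1) → (Fin N → K[X]) →ₗ[K] K) i P := by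
    cases i using Fin.cases <;> simp [leval]
  rw [hsnoc, hcons, checkForm, checkTarget, LinearMap.sub_apply, Pi.sub_apply,
    sub_eq_sub_iff_add_eq_add]

theorem checkForm_congr {i : Fin (N + 1)} {r r' : Fin N → K} {P P' : Fin N → K[X]}
    (hr : ∀ j, j.castSucc < i → r j = r' j) (hP : ∀ j, j.castSucc ≤ i → P j = P' j) :
    checkForm r i P = checkForm r' i P' := by
  rw [checkForm, checkForm, LinearMap.sub_apply, LinearMap.sub_apply]
  congr 1
  · cases i using Fin.lastCases with
    | last => simp
    | cast j => simp [hP j le_rfl]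
  · cases i using Fin.cases with
    | zero => simp
    | succ j => simp [hP j j.castSucc_lt_succ.le, hr j j.castSucc_lt_succ]

theorem checkForm_roundPoly (F : MvPolynomial (Fin N) K) (r : Fin N → K) (i : Fin (N + 1)) :
    checkForm r i (roundPoly F r) =
      checkTarget N (∑ x : Fin N → Bool, MvPolynomial.eval (fun j => if x j then 1 else 0) F)
        (MvPolynomial.eval r F) i := by
  rw [checkForm_eq_checkTarget_iff]
  trans cubeSum F {j | i ≤ j.castSucc} r
  · cases i using Fin.lastCases with
    | last => simp [Fin.castSucc_lt_last, cubeSum_empty, ← MvPolynomial.aeval_eq_eval, not_le.2]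
    | cast i =>
      have hfree : ({j | i.castSucc ≤ j.castSucc} : Finset (Fin N)) =
          insert i (Finset.Ioi i) := by
        ext j
        simp [le_iff_eq_or_lt]
      rw [hfree, cubeSum_insert F (by simp), Fin.snoc_castSucc, eval_roundPoly, eval_roundPoly]
  · cases i using Fin.cases with
    | zero => simp [cubeSum_univ, ← MvPolynomial.aeval_eq_eval]
    | succ i =>
      have hfree : ({j | i.succ ≤ j.castSucc} : Finset (Fin N)) = Finset.Ioi i := by
        ext j
        simp [Fin.succ_le_castSucc_iff]
      rw [hfree, Fin.cons_succ, eval_roundPoly, update_eq_self]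

theorem exists_eval_eq_zero_of_checkForm {r : Fin N → K} {a : K} (ha : a ≠ 0)
    {P : Fin N → K[X]} (hP : ∀ i, checkForm r i P = checkTarget N a 0 i) :
    ∃ j, P j ≠ 0 ∧ (P j).eval (r j) = 0 := by
  by_contra! hne
  simp only [checkForm_eq_checkTarget_iff] at hP
  have hcons : ∀ i, (Fin.cons a fun j => (P j).eval (r j) : Fin (N + 1) → K) i ≠ 0 := by
    refine Fin.induction (by simpa) fun j ih => ?_
    rw [← hP, Fin.snoc_castSucc] at ih
    simpa using hne j fun h => ih (by simp [h])
  exact hcons (Fin.last N) (by rw [← hP, Fin.snoc_last])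

end CheckForm

/-! ### Soundness of the masked sumcheck protocol -/

/-- A challenge of the verifier: the value of the next variable, and the coefficients of `t` random
tests of whether a mask vanishes. -/
abbrev Challenge (K : Type) (t : ℕ) : Type := K × (Fin t → K)

section Soundness

variable {K : Type} {N d t : ℕ}

/-- The point at which a sequence of challenges evaluates the polynomial of the sumcheck. The last
challenge only serves for its mask test. -/
def evalPoint (c : Fin (N + 1) → Challenge K t) (j : Fin N) : K := (c j.castSucc).1

variable [Field K] [Fintype K]

theorem prob_eval_eq_zero_le {p : K[X]} (hp : p ≠ 0) (hd : p.natDegree ≤ d) :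
    prob {x : Challenge K t | p.eval x.1 = 0} ≤ (d : ℝ) / Fintype.card K := by
  classical
  have hroots : {a : K | p.eval a = 0} = p.roots.toFinset := by
    ext a
    simp [hp]
  change prob (Prod.fst ⁻¹' {a : K | p.eval a = 0}) ≤ _
  rw [prob_preimage_fst, prob, hroots, Set.ncard_coe_finset]
  gcongr
  exact (Multiset.toFinset_card_le _).trans ((card_roots' p).trans hd)

theorem prob_mask_tests_pass_le (z : Fin t → K) {y : K} (hy : y ≠ 0) :
    prob {x : Challenge K t | ∀ l, z l + x.2 l * y = 0} ≤ 1 / (Fintype.card K : ℝ) ^ t := by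
  have hcoeff : {x : Challenge K t | ∀ l, z l + x.2 l * y = 0} ⊆
      Set.univ ×ˢ {fun l => -z l / y} := by
    intro x hx
    refine ⟨trivial, funext fun l => ?_⟩
    rw [eq_div_iff hy, ← add_eq_zero_iff_neg_eq.1 (hx l)]
  have hcard : (Fintype.card K : ℝ) ≠ 0 := by exact_mod_cast Fintype.card_ne_zero
  refine (prob_mono hcoeff).trans_eq ?_
  rw [prob, Set.ncard_prod, Set.ncard_univ, Set.ncard_singleton]
  simp [hcard, div_mul_cancel_left₀]

theorem prob_nonzero_mask_passes_le {y : (Fin (N + 1) → Challenge K t) → Fin (N + 1) → K}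
    {z : (Fin (N + 1) → Challenge K t) → Fin (N + 1) → Fin t → K}
    (hy : ∀ i, DependsOn (y · i) (Set.Iio i)) (hz : ∀ i, DependsOn (z · i) (Set.Iio i)) :
    prob {c | (∃ i, y c i ≠ 0) ∧ ∀ i l, z c i l + (c i).2 l * y c i = 0} ≤
      1 / (Fintype.card K : ℝ) ^ t := by
  let first (i : Fin (N + 1)) : Set (Fin (N + 1) → Challenge K t) :=
    {c | y c i ≠ 0 ∧ ∀ j < i, y c j = 0}
  let pass (i : Fin (N + 1)) (c : Fin (N + 1) → Challenge K t) : Set (Challenge K t) :=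
    {x | ∀ l, z c i l + x.2 l * y c i = 0}
  have hIio (i : Fin (N + 1)) : Set.Iio i ⊆ {i}ᶜ := fun j hj => ne_of_lt hj
  have hfirst (i : Fin (N + 1)) : DependsOn (· ∈ first i) {i}ᶜ := by
    refine DependsOn.mono (hIio i) fun c c' h => ?_
    have hle : ∀ j ≤ i, y c j = y c' j := fun j hj => hy j fun k hk => h k (hk.trans_le hj)
    simp only [first, Set.mem_ofPred_eq, eq_iff_iff, hle i le_rfl]
    exact and_congr_right' (forall₂_congr fun j hj => by rw [hle j hj.le])
  have hpass (i : Fin (N + 1)) : DependsOn (pass i) {i}ᶜ := by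
    refine DependsOn.mono (hIio i) fun c c' h => ?_
    simp only [pass, show y c i = y c' i from hy i h, show z c i = z c' i from hz i h]
  have hdisj : Pairwise (Disjoint on first) := by
    refine fun i j hij => Set.disjoint_left.2 fun c hi hj => ?_
    rcases hij.lt_or_gt with h | h
    · exact hi.1 (hj.2 i h)
    · exact hj.1 (hi.2 j h)
  calc prob {c | (∃ i, y c i ≠ 0) ∧ ∀ i l, z c i l + (c i).2 l * y c i = 0}
      ≤ prob (⋃ i, {c | c ∈ first i ∧ c i ∈ pass i c}) := by
        refine prob_mono fun c hc => Set.mem_iUnion.2 ?_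
        obtain ⟨i, hi, hmin⟩ := exists_minimal_of_wellFoundedLT (fun i => y c i ≠ 0) hc.1
        exact ⟨i, ⟨hi, fun j hj => by_contra fun h => (hmin h hj.le).not_gt hj⟩, hc.2 i⟩
    _ ≤ ∑ i, prob {c | c ∈ first i ∧ c i ∈ pass i c} := prob_iUnion_le _
    _ ≤ ∑ i, prob (first i) * (1 / (Fintype.card K : ℝ) ^ t) :=
        Finset.sum_le_sum fun i _ => prob_and_apply_mem_le i (hfirst i) (hpass i)
          fun c hc => prob_mask_tests_pass_le (z c i) hc.1
    _ ≤ 1 / (Fintype.card K : ℝ) ^ t := by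
        rw [← Finset.sum_mul, ← prob_iUnion hdisj]
        exact mul_le_of_le_one_left (by positivity) (prob_le_one _)

theorem prob_challenge_isRoot_le {p : (Fin (N + 1) → Challenge K t) → Fin N → K[X]}
    (hp : ∀ j, DependsOn (p · j) (Set.Iio j.castSucc)) (hd : ∀ c j, (p c j).natDegree ≤ d) :
    prob {c | ∃ j, p c j ≠ 0 ∧ (p c j).eval (evalPoint c j) = 0} ≤
      (N : ℝ) * d / Fintype.card K := by
  have hp' (j : Fin N) : DependsOn (p · j) {j.castSucc}ᶜ :=
    (hp j).mono fun k hk => ne_of_lt hk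
  rw [Set.ofPred_exists]
  calc prob (⋃ j, {c | p c j ≠ 0 ∧ (p c j).eval (evalPoint c j) = 0})
      ≤ ∑ j, prob {c | p c j ≠ 0 ∧ (p c j).eval (evalPoint c j) = 0} := prob_iUnion_le _
    _ ≤ ∑ _j : Fin N, (d : ℝ) / Fintype.card K := by
        refine Finset.sum_le_sum fun j _ => ?_
        refine (prob_and_apply_mem_le j.castSucc (D := {c | p c j ≠ 0})
          (T := fun c => {x | (p c j).eval x.1 = 0}) (b := d / Fintype.card K)
          (fun c c' h => ?_) (fun c c' h => ?_)
          fun c hc => prob_eval_eq_zero_le hc (hd c j)).trans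
            (mul_le_of_le_one_left (by positivity) (prob_le_one _))
        · simp only [Set.mem_ofPred_eq, show p c j = p c' j from hp' j h]
        · simp only [show p c j = p c' j from hp' j h]
    _ = (N : ℝ) * d / Fintype.card K := by simp [mul_div_assoc]

theorem prob_masked_checks_pass_le {F : MvPolynomial (Fin N) K} (hF : ∀ i, F.degreeOf i ≤ d)
    {a : K} (hne : ∑ x : Fin N → Bool, MvPolynomial.eval (fun i => if x i then 1 else 0) F ≠ a)
    {P : (Fin (N + 1) → Challenge K t) → Fin N → K[X]}
    {y : (Fin (N + 1) → Challenge K t) → Fin (N + 1) → K}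
    {z : (Fin (N + 1) → Challenge K t) → Fin (N + 1) → Fin t → K}
    (hP : ∀ j, DependsOn (P · j) (Set.Iio j.castSucc)) (hd : ∀ c j, (P c j).natDegree ≤ d)
    (hy : ∀ i, DependsOn (y · i) (Set.Iio i)) (hz : ∀ i, DependsOn (z · i) (Set.Iio i)) :
    prob {c | ∀ i, checkForm (evalPoint c) i (P c) + y c i =
        checkTarget N a (MvPolynomial.eval (evalPoint c) F) i ∧
        ∀ l, z c i l + (c i).2 l * y c i = 0} ≤
      (N : ℝ) * d / Fintype.card K + 1 / (Fintype.card K : ℝ) ^ t := by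
  let D (c : Fin (N + 1) → Challenge K t) (j : Fin N) : K[X] :=
    P c j - roundPoly F (evalPoint c) j
  have hD (j : Fin N) : DependsOn (D · j) (Set.Iio j.castSucc) := fun c c' h => by
    have hround := dependsOn_roundPoly F j fun k hk => congrArg Prod.fst (h k.castSucc hk)
    exact congrArg₂ (· - ·) (hP j h) hround
  have hDd (c : Fin (N + 1) → Challenge K t) (j : Fin N) : (D c j).natDegree ≤ d :=
    (natDegree_sub_le_of_le (hd c j) (natDegree_roundPoly_le F hF _ j)).trans_eq (max_self d)
  refine (prob_mono fun c hc => ?_).trans ((prob_union_le _ _).trans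
    (add_le_add (prob_challenge_isRoot_le hD hDd) (prob_nonzero_mask_passes_le hy hz)))
  by_cases hmask : ∃ i, y c i ≠ 0
  · exact Or.inr ⟨hmask, fun i => (hc i).2⟩
  · push Not at hmask
    refine Or.inl (exists_eval_eq_zero_of_checkForm (sub_ne_zero.2 hne.symm) fun i => ?_)
    have hcheck := (hc i).1
    rw [hmask i, add_zero] at hcheck
    rw [show D c = P c - roundPoly F (evalPoint c) from rfl, map_sub, hcheck,
      checkForm_roundPoly]
    simp [checkTarget, Pi.single_sub]

end Soundness

/-! ### Sharing a polynomial among the nodes -/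

section SharePoly

variable {K : Type*} [Field K] {n m d : ℕ}

/-- The polynomial of degree at most `d` whose coefficients in the degrees `v + n * k`, those that
the node `v` is in charge of, are given; the ones in degrees above `d` are ignored. -/
def blockPoly (d : ℕ) (v : Fin n) : (Fin m → K) →ₗ[K] K[X] :=
  ∑ k : Fin m, (if v + n * k ≤ d then monomial (v + n * k) else 0) ∘ₗ LinearMap.proj k

/-- The coefficients of `p` that the node `v` is in charge of. -/
def blockCoeffs (v : Fin n) (p : K[X]) (k : Fin m) : K := p.coeff (v + n * k)

theorem natDegree_blockPoly_le (v : Fin n) (w : Fin m → K) : (blockPoly d v w).natDegree ≤ d := by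
  rw [blockPoly, LinearMap.sum_apply]
  refine natDegree_sum_le_of_forall_le _ _ fun k _ => ?_
  split_ifs with h
  · exact (natDegree_monomial_le _).trans h
  · simp

theorem sum_blockPoly_blockCoeffs {p : K[X]} (hp : p.natDegree ≤ d) (hd : d < m * n) :
    ∑ v : Fin n, blockPoly d v (blockCoeffs v p : Fin m → K) = p := by
  have hterm (v : Fin n) (k : Fin m) : ((if v + n * k ≤ d then monomial (v + n * k) else 0) ∘ₗ
      LinearMap.proj k) (blockCoeffs v p : Fin m → K) =
        monomial (finProdFinEquiv (k, v)) (p.coeff (finProdFinEquiv (k, v))) := by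
    rw [LinearMap.comp_apply, LinearMap.proj_apply, blockCoeffs, finProdFinEquiv_apply_val]
    split_ifs with h
    · rfl
    · rw [coeff_eq_zero_of_natDegree_lt (by omega), LinearMap.zero_apply, monomial_zero_right]
  simp only [blockPoly, LinearMap.sum_apply, hterm]
  rw [Finset.sum_comm, ← Fintype.sum_prod_type', finProdFinEquiv.sum_comp fun j =>
    monomial (j : ℕ) (p.coeff j), Fin.sum_univ_eq_sum_range fun j => monomial j (p.coeff j)]
  exact (p.as_sum_range' _ (hp.trans_lt hd)).symm

variable [NeZero n]

/-- What the node `v` contributes to a shared polynomial: it holds shares `left` of its own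
coefficients and `right` of those of its cyclic predecessor. -/
def sharePoly (d : ℕ) (v : Fin n) (left right : Fin m → K) : K[X] :=
  blockPoly d v left + blockPoly d (v - 1) right

theorem natDegree_sharePoly_le (v : Fin n) (left right : Fin m → K) :
    (sharePoly d v left right).natDegree ≤ d :=
  natDegree_add_le_of_degree_le (natDegree_blockPoly_le _ _) (natDegree_blockPoly_le _ _)

theorem sum_sharePoly {p : K[X]} (hp : p.natDegree ≤ d) (hd : d < m * n)
    (s : Fin n → Fin m → K) :
    ∑ v, sharePoly d v (s v) (blockCoeffs (v - 1) p - s (v - 1)) = p := by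
  have hshift : ∑ v, blockPoly d (v - 1) (blockCoeffs (v - 1) p - s (v - 1)) =
      ∑ v, blockPoly d v (blockCoeffs v p - s v) :=
    (Equiv.subRight (1 : Fin n)).sum_comp fun v => blockPoly d v (blockCoeffs v p - s v)
  simp only [sharePoly, Finset.sum_add_distrib, hshift]
  simp only [map_sub, Finset.sum_sub_distrib, add_sub_cancel, sum_blockPoly_blockCoeffs hp hd]

end SharePoly

/-! ### The test of a node -/

section NodeCheck

/-- What the prover commits to at a node in one phase: the shares `left` and `right` of
coefficients, the mask of the next check, and the values that blind the tests of the mask. -/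
@[ext] structure Commit (K : Type) (m t : ℕ) where
  left : Fin m → K
  right : Fin m → K
  mask : K
  blind : Fin t → K

/-- What the prover reveals to a node in one phase: the challenge of the root, and the sums over the
subtree of the node in the masked check and in the tests of the mask. -/
@[ext] structure Reveal (K : Type) (t : ℕ) where
  chal : Challenge K t
  sum : K
  test : Fin t → K

variable {K : Type} {n N d m t : ℕ}

/-- A commitment as a tuple. -/
def Commit.equivProd : Commit K m t ≃ (Fin m → K) × (Fin m → K) × K × (Fin t → K) where
  toFun c := (c.left, c.right, c.mask, c.blind)
  invFun p := ⟨p.1, p.2.1, p.2.2.1, p.2.2.2⟩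

/-- A revealed message as a tuple. -/
def Reveal.equivProd : Reveal K t ≃ Challenge K t × K × (Fin t → K) where
  toFun r := (r.chal, r.sum, r.test)
  invFun p := ⟨p.1, p.2.1, p.2.2⟩

instance [Fintype K] : Fintype (Commit K m t) := Fintype.ofEquiv _ Commit.equivProd.symm

instance [Fintype K] : Fintype (Reveal K t) := Fintype.ofEquiv _ Reveal.equivProd.symm

instance [Zero K] : Inhabited (Commit K m t) := ⟨⟨0, 0, 0, 0⟩⟩

instance [Zero K] : Inhabited (Reveal K t) := ⟨⟨0, 0, 0⟩⟩

theorem card_commit [Fintype K] :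
    Fintype.card (Commit K m t) = Fintype.card K ^ (2 * m + t + 1) := by
  rw [Fintype.card_congr Commit.equivProd]
  simp only [Fintype.card_prod, Fintype.card_fun, Fintype.card_fin]
  ring

theorem card_reveal [Fintype K] : Fintype.card (Reveal K t) = Fintype.card K ^ (2 * t + 2) := by
  rw [Fintype.card_congr Reveal.equivProd]
  simp only [Fintype.card_prod, Fintype.card_fun, Fintype.card_fin]
  ring

variable [Field K]

/-- What the children of `v` in the tree of `parent` tell `v`, if each node `u` tells `r u`. -/
def childData {α : Type} (parent : Fin n → Option (Fin n)) (r : Fin n → α) (v u : Fin n) :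
    Option α :=
  if parent u = some v then some (r u) else none

theorem treeMatrix_mulVec_eq_sub_sum_childData {α : Type} {parent : Fin n → Option (Fin n)}
    (r : Fin n → α) (f : α → K) (v : Fin n) :
    (treeMatrix K parent *ᵥ fun u => f (r u)) v =
      f (r v) - ∑ u, (childData parent r v u).elim 0 f := by
  rw [treeMatrix_mulVec_apply]
  congr 1
  refine Finset.sum_congr rfl fun u _ => ?_
  unfold childData
  split_ifs <;> rfl

variable [NeZero n]

/-- What the node `v` contributes to the polynomials of the rounds of the sumcheck. -/
def nodePoly (d : ℕ) (v : Fin n) (left right : Fin (N + 1) → Fin m → K) (j : Fin N) : K[X] :=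
  sharePoly d v (left j.castSucc) (right j.castSucc)

/-- The test of the node `v` at the end: `a` is the claimed sum, `b` the answer of the oracle,
`c` are the coins of the node, `commit` and `reveal` what it got from the prover, and `kids` what
its children told it. The challenges `c` and the numbers `a` and `b` only matter at the root. -/
structure NodeCheck (d : ℕ) (v : Fin n) (a b : K) (c : Fin (N + 1) → Challenge K t)
    (commit : Fin (N + 1) → Commit K m t) (reveal : Fin (N + 1) → Reveal K t)
    (kids : Fin n → Option (Fin (N + 1) → Reveal K t)) : Prop where
  root_chal : v = 0 → ∀ i, (reveal i).chal = c i
  root_sum : v = 0 → ∀ i, (reveal i).sum = checkTarget N a b i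
  root_test : v = 0 → ∀ i, (reveal i).test = 0
  kid_chal : ∀ u r, kids u = some r → ∀ i, (r i).chal = (reveal i).chal
  sum_eq : ∀ i, (reveal i).sum = checkForm (evalPoint fun j => (reveal j).chal) i
    (nodePoly d v (fun j => (commit j).left) fun j => (commit j).right) + (commit i).mask +
      ∑ u, (kids u).elim 0 fun r => (r i).sum
  test_eq : ∀ i l, (reveal i).test l = (commit i).blind l + (reveal i).chal.2 l * (commit i).mask +
    ∑ u, (kids u).elim 0 fun r => (r i).test l

section AllNodes

variable {parent : Fin n → Option (Fin n)} {a : K} {b : Fin n → K}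
  {c : Fin n → Fin (N + 1) → Challenge K t} {commit : Fin n → Fin (N + 1) → Commit K m t}
  {reveal : Fin n → Fin (N + 1) → Reveal K t}

theorem chal_eq_of_nodeCheck (htree : IsRootedTree parent 0)
    (h : ∀ v, NodeCheck d v a (b v) (c v) (commit v) (reveal v) (childData parent reveal v))
    (v : Fin n) : (fun i => (reveal v i).chal) = c 0 := by
  have hparent (u w : Fin n) (huw : parent u = some w) :
      (fun i => (reveal u i).chal) = fun i => (reveal w i).chal :=
    funext ((h w).kid_chal u (reveal u) (if_pos huw))
  exact (htree.apply_eq_apply_root hparent v).trans (funext ((h 0).root_chal rfl))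

theorem root_checks_of_nodeCheck (htree : IsRootedTree parent 0)
    (h : ∀ v, NodeCheck d v a (b v) (c v) (commit v) (reveal v) (childData parent reveal v))
    (i : Fin (N + 1)) :
    checkForm (evalPoint (c 0)) i
        (∑ v, nodePoly d v (fun j => (commit v j).left) fun j => (commit v j).right) +
      ∑ v, (commit v i).mask = checkTarget N a (b 0) i ∧
    ∀ l, ∑ v, (commit v i).blind l + (c 0 i).2 l * ∑ v, (commit v i).mask = 0 := by
  have hchal := chal_eq_of_nodeCheck htree h
  constructor
  · rw [← (h 0).root_sum rfl i, ← htree.sum_treeMatrix_mulVec (K := K) fun v => (reveal v i).sum,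
      map_sum, ← Finset.sum_add_distrib]
    refine Finset.sum_congr rfl fun v _ => ?_
    rw [treeMatrix_mulVec_eq_sub_sum_childData reveal fun r => (r i).sum, (h v).sum_eq, hchal,
      add_sub_cancel_right]
  · intro l
    rw [← Pi.zero_apply (M := fun _ => K) l, ← (h 0).root_test rfl i,
      ← htree.sum_treeMatrix_mulVec (K := K) fun v => (reveal v i).test l, Finset.mul_sum,
      ← Finset.sum_add_distrib]
    refine Finset.sum_congr rfl fun v _ => ?_
    rw [treeMatrix_mulVec_eq_sub_sum_childData reveal fun r => (r i).test l, (h v).test_eq,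
      congrFun (hchal v) i, add_sub_cancel_right]

end AllNodes

/-- The only commitments with the shares `left` and `right` that pass the test of the node `v`. -/
def solveCommit (d : ℕ) (v : Fin n) (left right : Fin (N + 1) → Fin m → K)
    (reveal : Fin (N + 1) → Reveal K t) (kids : Fin n → Option (Fin (N + 1) → Reveal K t))
    (i : Fin (N + 1)) : Commit K m t :=
  let mask := (reveal i).sum -
    checkForm (evalPoint fun j => (reveal j).chal) i (nodePoly d v left right) -
      ∑ u, (kids u).elim 0 fun r => (r i).sum
  { left := left i
    right := right i
    mask := mask
    blind := fun l => (reveal i).test l - (reveal i).chal.2 l * mask -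
      ∑ u, (kids u).elim 0 fun r => (r i).test l }

theorem NodeCheck.commit_eq {v : Fin n} {a b : K} {c : Fin (N + 1) → Challenge K t}
    {commit : Fin (N + 1) → Commit K m t} {reveal : Fin (N + 1) → Reveal K t}
    {kids : Fin n → Option (Fin (N + 1) → Reveal K t)}
    (h : NodeCheck d v a b c commit reveal kids) :
    commit = solveCommit d v (fun j => (commit j).left) (fun j => (commit j).right)
      reveal kids := by
  have hmask (i : Fin (N + 1)) : (commit i).mask = (solveCommit d v (fun j => (commit j).left)
      (fun j => (commit j).right) reveal kids i).mask := by
    linear_combination (norm := (simp only [solveCommit]; ring)) -h.sum_eq i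
  funext i
  refine Commit.ext rfl rfl (hmask i) (funext fun l => ?_)
  change _ = (reveal i).test l - (reveal i).chal.2 l * (solveCommit _ _ _ _ _ _ i).mask - _
  rw [← hmask i]
  linear_combination -h.test_eq i l

end NodeCheck

/-! ### Algorithms with one round and one query of the root -/

section OneRound

variable {n N q B : ℕ} [NeZero n] {In Out Coin : Type} [Fintype Coin] [Nonempty Coin]

/-- The distributed algorithm in which the root queries the oracle at the point `pt`, and then every
node sends `send` to its neighbours, in the only round, and outputs `output`. -/
def oneRoundAlg (ident : In → Fin n) (pt : In → Coin → Fin N → ZMod q)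
    (send : In → Fin n → Msg B) (output : In → Coin → LocalHist n q B → Out) :
    DistAlg n N q In Out where
  rounds := 1
  bits := B
  Coin := Coin
  query x c h := if ident x = 0 ∧ h.inbox = [] then some (pt x c) else none
  send x _ _ u := send x u
  output := output

variable {ident : In → Fin n} {pt : In → Coin → Fin N → ZMod q} {send : In → Fin n → Msg B}
  {output : In → Coin → LocalHist n q B → Out} (G : SimpleGraph (Fin n))
  (O : (Fin N → ZMod q) → ZMod q) {x : Fin n → In}

open Classical in
theorem finalHist_oneRoundAlg (hx : ∀ v, ident (x v) = v) (c : Fin n → Coin) (v : Fin n) :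
    (oneRoundAlg ident pt send output).finalHist G O x c v =
      ⟨[if v = 0 then some (O (pt (x 0) (c 0))) else none, none],
        [fun u => if G.Adj u v then some (send (x u) v) else none]⟩ := by
  by_cases hv : v = 0 <;> simp [DistAlg.finalHist, oneRoundAlg, DistAlg.hist, DistAlg.ask, hx, hv]

theorem queryCount_oneRoundAlg (hx : ∀ v, ident (x v) = v) (c : Fin n → Coin) :
    (oneRoundAlg ident pt send output).queryCount G O x c = 1 := by
  unfold DistAlg.queryCount
  rw [Fintype.sum_eq_single 0]
  · rw [finalHist_oneRoundAlg G O hx]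
    simp [List.reduceOption]
  · intro v hv
    rw [finalHist_oneRoundAlg G O hx]
    simp [hv, List.reduceOption]

end OneRound

/-! ### The protocol -/

section Protocol

/-- The number of coefficients of a polynomial of degree at most `d` that each of `n` nodes is in
charge of. -/
abbrev slots (n d : ℕ) : ℕ := d / n + 1

theorem lt_slots_mul (n d : ℕ) [NeZero n] : d < slots n d * n :=
  Nat.lt_mul_of_div_lt (Nat.lt_succ_self _) (Nat.pos_of_neZero n)

/-- The number of bits of an element of `ZMod q`. -/
abbrev width (q : ℕ) : ℕ := Nat.log 2 q + 1

/-- The length of the messages that are exchanged with the prover. -/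
abbrev proverBits (n d t q : ℕ) : ℕ := (2 * slots n d + 3 * t + 3) * width q

/-- The length of the messages between nodes. -/
abbrev nodeBits (N t q : ℕ) : ℕ := (2 * t + 2) * (N + 1) * width q + 1

/-- A message of the prover: the commitment of one phase and what is revealed of the phase before.
The first and the last message lack one of the two parts. -/
abbrev ProverMsg (n d t q : ℕ) : Type := Commit (ZMod q) (slots n d) t × Reveal (ZMod q) t

/-- A message between nodes: a node tells its parent what has been revealed to it, and nothing to
its other neighbours. -/
abbrev NodeMsg (N t q : ℕ) : Type := Option (Fin (N + 1) → Reveal (ZMod q) t)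

section Card

variable {n N d t q : ℕ} [Fact q.Prime]

theorem card_pow_le {k b : ℕ} (h : k * width q ≤ b) : Fintype.card (ZMod q) ^ k ≤ 2 ^ b :=
  calc Fintype.card (ZMod q) ^ k ≤ (2 ^ width q) ^ k := by
        rw [ZMod.card]
        exact Nat.pow_le_pow_left (Nat.lt_pow_succ_log_self one_lt_two q).le k
    _ = 2 ^ (k * width q) := by rw [← pow_mul, mul_comm]
    _ ≤ 2 ^ b := Nat.pow_le_pow_right two_pos h

theorem card_proverMsg_le : Fintype.card (ProverMsg n d t q) ≤ 2 ^ proverBits n d t q := by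
  rw [Fintype.card_prod, card_commit, card_reveal, ← pow_add]
  exact card_pow_le (Nat.mul_le_mul_right _ (by lia))

theorem card_challenge_le :
    Fintype.card (Challenge (ZMod q) t) ≤ 2 ^ proverBits n d t q := by
  rw [Fintype.card_prod, Fintype.card_fun, Fintype.card_fin, ← pow_succ']
  exact card_pow_le (Nat.mul_le_mul_right _ (by lia))

theorem card_nodeMsg_le : Fintype.card (NodeMsg N t q) ≤ 2 ^ nodeBits N t q := by
  rw [Fintype.card_option, Fintype.card_fun, Fintype.card_fin, card_reveal, ← pow_mul, pow_succ,
    mul_two]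
  exact add_le_add (card_pow_le le_rfl) Nat.one_le_two_pow

end Card

section Decode

variable (n d t q : ℕ) {N : ℕ} [Fact q.Prime]

/-- The commitments in the list of all messages that a node exchanged with the prover. Message
`2 * i` is the one of the prover that opens phase `i`, and message `2 * i + 1` the challenge of the
node. -/
def commitOf (τ : List (Msg (proverBits n d t q))) (i : Fin (N + 1)) :
    Commit (ZMod q) (slots n d) t :=
  (decode (τ.getD (2 * i) default) : ProverMsg n d t q).1

/-- The revealed values in the list of all messages that a node exchanged with the prover. -/
def revealOf (τ : List (Msg (proverBits n d t q))) (i : Fin (N + 1)) : Reveal (ZMod q) t :=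
  (decode (τ.getD (2 * i + 2) default) : ProverMsg n d t q).2

end Decode

open Classical in
/-- What a node has received at the end of the verification if it got the answer `ans` from the
oracle, its neighbours are `nbrs`, and they told it `kids`. -/
def receivedHist {n N t q : ℕ} [Fact q.Prime] (ans : Option (ZMod q)) (nbrs : Set (Fin n))
    (kids : Fin n → NodeMsg N t q) : LocalHist n q (nodeBits N t q) :=
  ⟨[ans, none], [fun u => if u ∈ nbrs then some (encode (nodeBits N t q) (kids u)) else none]⟩

theorem bind_decode_receivedHist {n N t q : ℕ} [Fact q.Prime] {kids : Fin n → NodeMsg N t q}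
    {ans : Option (ZMod q)} {nbrs : Set (Fin n)} (hkids : ∀ u ∉ nbrs, kids u = none) (u : Fin n) :
    ((receivedHist ans nbrs kids).inbox.getD 0 (fun _ => none) u).bind
      (fun m => (decode m : NodeMsg N t q)) = kids u := by
  by_cases hu : u ∈ nbrs
  · simp [receivedHist, hu, decode_encode card_nodeMsg_le]
  · simp [receivedHist, hu, hkids u hu]

variable (n N d t q : ℕ) [NeZero n] [Fact q.Prime]

open Classical in
/-- The verification: the root queries the oracle at the point given by its challenges, each node
tells its parent what has been revealed to it, and then it makes its test. -/
def verification : DistAlg n N q (LocalInput n q × (Fin (N + 1) → Challenge (ZMod q) t) ×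
    List (Msg (proverBits n d t q))) Bool :=
  oneRoundAlg (B := nodeBits N t q) (Coin := Unit) (fun x => x.1.id) (fun x _ => evalPoint x.2.1)
    (fun x u => encode (nodeBits N t q) (α := NodeMsg N t q)
      (if x.1.parent = some u then some (revealOf n d t q x.2.2) else none))
    fun x _ h => decide (NodeCheck d x.1.id x.1.target ((h.answers.getD 0 none).getD 0) x.2.1
      (commitOf n d t q x.2.2) (revealOf n d t q x.2.2)
      fun u => (h.inbox.getD 0 (fun _ => none) u).bind fun m => (decode m : NodeMsg N t q))

/-- The protocol: there are `N + 1` phases, in each of which the prover commits and every node sends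
a challenge (only that of the root matters). The prover reveals its values for a phase in the next
message. -/
abbrev protocol : DIP n N q where
  rounds := 2 * N + 3
  bits := proverBits n d t q
  Coin := Fin (N + 1) → Challenge (ZMod q) t
  nodeMsg _ c τ := encode (proverBits n d t q) (c (Fin.ofNat (N + 1) (τ.length / 2)))
  verifier := verification n N d t q

variable {n N d t q}

/-- What the root (but no other node) learns from the oracle if its challenges are `c`. -/
def rootAnswer (I : SumcheckInstance n N d q) (v : Fin n) (c : Fin (N + 1) → Challenge (ZMod q) t) :
    Option (ZMod q) :=
  if v = 0 then some (I.oracle (evalPoint c)) else none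

variable (P : Prover n (proverBits n d t q)) (I : SumcheckInstance n N d q)
  (ω : (protocol n N d t q).Coins P)

theorem finalHist_verification (v : Fin n) :
    (verification n N d t q).finalHist I.graph I.oracle
        ((protocol n N d t q).verifierInput P I ω) ω.2.1 v =
      receivedHist (rootAnswer I v (ω.1 0)) (I.localInput v).nbrs (childData I.parent
        (fun u => revealOf n d t q ((protocol n N d t q).nodeTranscript P I ω u)) v) := by
  have hnbrs : (I.localInput v).nbrs = {u | I.graph.Adj u v} :=
    Set.ext fun u => I.graph.adj_comm v u
  rw [hnbrs]
  exact finalHist_oneRoundAlg _ _ (fun _ => rfl) _ v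

theorem queryCount_protocol : (protocol n N d t q).queryCount P I ω = 1 :=
  queryCount_oneRoundAlg _ _ (fun _ => rfl) _

theorem accepts_iff : (protocol n N d t q).Accepts P I ω ↔
    ∀ v, NodeCheck d v I.target ((rootAnswer I v (ω.1 0)).getD 0) (ω.1 v)
      (commitOf n d t q ((protocol n N d t q).nodeTranscript P I ω v))
      (revealOf n d t q ((protocol n N d t q).nodeTranscript P I ω v))
      (childData I.parent
        (fun u => revealOf n d t q ((protocol n N d t q).nodeTranscript P I ω u)) v) := by
  refine forall_congr' fun v => ?_
  have hkids (u : Fin n) (hu : u ∉ (I.localInput v).nbrs) : childData I.parent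
      (fun u => revealOf n d t q ((protocol n N d t q).nodeTranscript P I ω u)) v u =
        (none : NodeMsg N t q) :=
    if_neg fun h => hu (I.parent_adj u v h).symm
  classical
  refine decide_eq_true_iff.trans ?_
  rw [finalHist_verification]
  simp only [bind_decode_receivedHist hkids]
  rfl

end Protocol

/-! ### Transcripts -/

section Transcript

variable {n N d t q : ℕ} [NeZero n]

/-- The messages exchanged in round `j` of the interaction, in the direction that depends on the
parity of `j`. -/
def DIP.roundMsg (p : DIP n N q) (P : Prover n p.bits) (I : SumcheckInstance n N d q)
    (ω : p.Coins P) (j : ℕ) : Fin n → Msg p.bits :=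
  if Odd (p.rounds - j) then P.msg ω.2.2 (p.transcript P I ω j)
  else fun v => p.nodeMsg (I.localInput v) (ω.1 v) ((p.transcript P I ω j).map fun m => m v)

theorem DIP.transcript_eq_map_roundMsg (p : DIP n N q) (P : Prover n p.bits)
    (I : SumcheckInstance n N d q) (ω : p.Coins P) (k : ℕ) :
    p.transcript P I ω k = (List.range k).map (p.roundMsg P I ω) := by
  induction k with
  | zero => rfl
  | succ k ih => rw [List.range_succ, List.map_append, ← ih]; rfl

theorem DIP.nodeTranscript_eq_map_roundMsg (p : DIP n N q) (P : Prover n p.bits)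
    (I : SumcheckInstance n N d q) (ω : p.Coins P) (v : Fin n) :
    p.nodeTranscript P I ω v = (List.range p.rounds).map fun j => p.roundMsg P I ω j v := by
  rw [DIP.nodeTranscript, DIP.transcript_eq_map_roundMsg, List.map_map]
  rfl

variable [Fact q.Prime] (P : Prover n (proverBits n d t q)) (I : SumcheckInstance n N d q)
  (ω : (protocol n N d t q).Coins P)

theorem roundMsg_prover (i : Fin (N + 2)) :
    (protocol n N d t q).roundMsg P I ω (2 * i) =
      P.msg ω.2.2 ((protocol n N d t q).transcript P I ω (2 * i)) :=
  if_pos (show Odd (2 * N + 3 - 2 * i) by grind)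

theorem roundMsg_node (i : Fin (N + 1)) :
    (protocol n N d t q).roundMsg P I ω (2 * i + 1) =
      fun v => encode (proverBits n d t q) (ω.1 v i) := by
  refine (if_neg (show ¬ Odd (2 * N + 3 - (2 * i + 1)) by grind)).trans (funext fun v => ?_)
  have hphase : Fin.ofNat (N + 1) ((2 * i + 1) / 2) = i := by
    rw [show (2 * i + 1 : ℕ) / 2 = i by lia, Fin.ofNat_val_eq_self]
  simp only [DIP.transcript_eq_map_roundMsg, List.length_map, List.length_range, hphase]

theorem commitOf_nodeTranscript (v : Fin n) (i : Fin (N + 1)) :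
    commitOf n d t q ((protocol n N d t q).nodeTranscript P I ω v) i =
      (decode ((protocol n N d t q).roundMsg P I ω (2 * i) v) : ProverMsg n d t q).1 := by
  have hi : 2 * (i : ℕ) < 2 * N + 3 := by lia
  simp [commitOf, DIP.nodeTranscript_eq_map_roundMsg, hi]

end Transcript

/-! ### Soundness -/

section Soundness

variable {n N d t q : ℕ} [NeZero n] [Fact q.Prime] (P : Prover n (proverBits n d t q))
  (I : SumcheckInstance n N d q) (ω : (protocol n N d t q).Coins P)

theorem transcript_congr {ω' : (protocol n N d t q).Coins P} (hP : ω.2.2 = ω'.2.2) {k : ℕ}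
    (hk : k ≤ 2 * N + 3) (h : ∀ v (i : Fin (N + 1)), 2 * (i : ℕ) + 1 < k → ω.1 v i = ω'.1 v i) :
    (protocol n N d t q).transcript P I ω k = (protocol n N d t q).transcript P I ω' k := by
  induction k with
  | zero => rfl
  | succ k ih =>
    have hbefore := ih (by lia) fun v i hi => h v i (by lia)
    suffices (protocol n N d t q).roundMsg P I ω k = (protocol n N d t q).roundMsg P I ω' k from
      congrArg₂ (· ++ [·]) hbefore this
    rcases Nat.even_or_odd' k with ⟨i, rfl | rfl⟩
    · rw [roundMsg_prover P I ω ⟨i, by lia⟩, roundMsg_prover P I ω' ⟨i, by lia⟩]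
      exact congrArg₂ P.msg hP hbefore
    · rw [roundMsg_node P I ω ⟨i, by lia⟩, roundMsg_node P I ω' ⟨i, by lia⟩]
      exact funext fun v => congrArg _ (h v _ (Nat.lt_succ_self _))

theorem dependsOn_commitOf (v : Fin n) (i : Fin (N + 1)) :
    DependsOn (fun c : Fin (N + 1) → Challenge (ZMod q) t => commitOf n d t q
      ((protocol n N d t q).nodeTranscript P I (update ω.1 0 c, ω.2) v) i) (Set.Iio i) := by
  intro c c' h
  have hbefore : (protocol n N d t q).transcript P I (update ω.1 0 c, ω.2) (2 * i) =
      (protocol n N d t q).transcript P I (update ω.1 0 c', ω.2) (2 * i) := by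
    refine transcript_congr P I (update ω.1 0 c, ω.2) (ω' := (update ω.1 0 c', ω.2)) rfl (by lia)
      fun u j hj => ?_
    rcases eq_or_ne u 0 with rfl | hu
    · simpa using h j (Fin.lt_def.2 (by lia))
    · simp [hu]
  have hround (ω' : (protocol n N d t q).Coins P) :
      (protocol n N d t q).roundMsg P I ω' (2 * i) =
        P.msg ω'.2.2 ((protocol n N d t q).transcript P I ω' (2 * i)) :=
    roundMsg_prover P I ω' i.castSucc
  simp only [commitOf_nodeTranscript, hround]
  exact congrArg (fun τ => (decode (P.msg ω.2.2 τ v) : ProverMsg n d t q).1) hbefore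

theorem prob_accepts_update_root_le (hI : ¬ I.Claim) :
    prob {c | (protocol n N d t q).Accepts P I (update ω.1 0 c, ω.2)} ≤
      (N : ℝ) * d / q + 1 / (q : ℝ) ^ t := by
  let commit (c : Fin (N + 1) → Challenge (ZMod q) t) (v : Fin n) (i : Fin (N + 1)) :=
    commitOf n d t q ((protocol n N d t q).nodeTranscript P I (update ω.1 0 c, ω.2) v) i
  have hcommit (v : Fin n) (i : Fin (N + 1)) : DependsOn (commit · v i) (Set.Iio i) :=
    dependsOn_commitOf P I ω v i
  have hsum {α : Type} [AddCommMonoid α] (f : Commit (ZMod q) (slots n d) t → Fin n → α)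
      (i : Fin (N + 1)) : DependsOn (fun c => ∑ v, f (commit c v i) v) (Set.Iio i) :=
    fun c c' h => Finset.sum_congr rfl fun v _ => congrArg (f · v) (hcommit v i h)
  have hsound := prob_masked_checks_pass_le I.degreeOf_le hI
    (P := fun c => ∑ v, nodePoly d v (fun i => (commit c v i).left) fun i => (commit c v i).right)
    (y := fun c i => ∑ v, (commit c v i).mask) (z := fun c i l => ∑ v, (commit c v i).blind l)
    (fun j => by
      simpa only [Finset.sum_apply, nodePoly] using
        hsum (fun x v => sharePoly d v x.left x.right) j.castSucc)
    (fun c j => by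
      rw [Finset.sum_apply]
      exact natDegree_sum_le_of_forall_le _ _ fun v _ => natDegree_sharePoly_le _ _ _)
    (hsum fun x _ => x.mask)
    fun i => by simpa only [← Finset.sum_apply] using hsum (fun x _ => x.blind) i
  rw [ZMod.card] at hsound
  refine (prob_mono fun c hc i => ?_).trans hsound
  have hroot := root_checks_of_nodeCheck I.isRootedTree ((accepts_iff P I _).1 hc) i
  simpa [rootAnswer, SumcheckInstance.oracle] using hroot

theorem protocol_soundness (ht : 0 < t) (hI : ¬ I.Claim) :
    (protocol n N d t q).acceptProb P I ≤ (N : ℝ) * d / q + 1 / t := by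
  have hpow : t ≤ q ^ t :=
    Nat.lt_two_pow_self.le.trans (Nat.pow_le_pow_left (Fact.out : q.Prime).two_le t)
  calc (protocol n N d t q).acceptProb P I
      ≤ (N : ℝ) * d / q + 1 / (q : ℝ) ^ t :=
        prob_le_of_forall_prob_fst_le fun y => prob_le_of_forall_prob_update_le 0 fun x =>
          prob_accepts_update_root_le P I (x, y) hI
    _ ≤ (N : ℝ) * d / q + 1 / t := by
        gcongr
        exact_mod_cast hpow

end Soundness

/-! ### The honest prover -/

section Phase

variable {n N d t q : ℕ} [Fact q.Prime]

/-- The messages of the prover to a node in all phases, if it commits to `commit` and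
reveals `reveal`. -/
def phaseMsg (commit : Fin (N + 1) → Commit (ZMod q) (slots n d) t)
    (reveal : Fin (N + 1) → Reveal (ZMod q) t) (k : Fin (N + 2)) : ProverMsg n d t q :=
  ((Fin.snoc commit default : Fin (N + 2) → Commit (ZMod q) (slots n d) t) k,
    (Fin.cons default reveal : Fin (N + 2) → Reveal (ZMod q) t) k)

/-- All messages between a node with the challenges `c` and a prover that sends it `msg`. -/
def transcriptOf (c : Fin (N + 1) → Challenge (ZMod q) t) (msg : Fin (N + 2) → ProverMsg n d t q) :
    List (Msg (proverBits n d t q)) :=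
  (List.range (2 * N + 3)).map fun j =>
    if Even j then encode _ (msg (Fin.ofNat (N + 2) (j / 2)))
    else encode _ (c (Fin.ofNat (N + 1) (j / 2)))

variable (c : Fin (N + 1) → Challenge (ZMod q) t)
  (commit : Fin (N + 1) → Commit (ZMod q) (slots n d) t)
  (reveal : Fin (N + 1) → Reveal (ZMod q) t)

theorem commitOf_transcriptOf :
    commitOf n d t q (transcriptOf c (phaseMsg commit reveal)) = commit := by
  funext i
  have hi : 2 * (i : ℕ) < 2 * N + 3 := by lia
  simp [commitOf, transcriptOf, hi, decode_encode card_proverMsg_le, phaseMsg]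

theorem revealOf_transcriptOf :
    revealOf n d t q (transcriptOf c (phaseMsg commit reveal)) = reveal := by
  funext i
  have hi : 2 * (i : ℕ) + 2 < 2 * N + 3 := by lia
  have heven : Even (2 * (i : ℕ) + 2) := by grind
  have hphase : Fin.ofNat (N + 2) (i + 1) = i.succ := Fin.ofNat_val_eq_self i.succ
  simp [revealOf, transcriptOf, hi, heven, hphase, decode_encode card_proverMsg_le, phaseMsg,
    -Fin.ofNat_eq_cast]

end Phase

section Honest

/-- The coins of the honest prover: shares of the coefficients, sums over the subtrees in
the masked checks, and sums over the subtrees of the blinding values. -/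
@[ext] structure ProverCoin (K : Type) (n N m t : ℕ) where
  share : Fin (N + 1) → Fin n → Fin m → K
  sum : Fin (N + 1) → Fin n → K
  blind : Fin (N + 1) → Fin t → Fin n → K

section Coin

variable {K : Type} {n N m t : ℕ}

/-- The coins of the honest prover as a tuple. -/
def ProverCoin.equivProd : ProverCoin K n N m t ≃ (Fin (N + 1) → Fin n → Fin m → K) ×
    (Fin (N + 1) → Fin n → K) × (Fin (N + 1) → Fin t → Fin n → K) where
  toFun κ := (κ.share, κ.sum, κ.blind)
  invFun p := ⟨p.1, p.2.1, p.2.2⟩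

instance [Fintype K] : Fintype (ProverCoin K n N m t) :=
  Fintype.ofEquiv _ ProverCoin.equivProd.symm

instance [Nonempty K] : Nonempty (ProverCoin K n N m t) :=
  ProverCoin.equivProd.nonempty

end Coin

variable {n N d t q : ℕ} [NeZero n] [Fact q.Prime] (I : SumcheckInstance n N d q)
  (κ : ProverCoin (ZMod q) n N (slots n d) t)
  (c : Fin (N + 1) → Challenge (ZMod q) t) (i : Fin (N + 1))

/-- The polynomial that is shared in phase `i` when the challenges of the root are `c`: the one of
round `i` of the sumcheck, and nothing in the last phase. -/
def honestPoly : (ZMod q)[X] :=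
  (Fin.snoc (roundPoly I.poly (evalPoint c)) 0 : Fin (N + 1) → (ZMod q)[X]) i

/-- The share of the coefficients of its predecessor that the node `v` gets in phase `i`. -/
def honestRight (v : Fin n) : Fin (slots n d) → ZMod q :=
  blockCoeffs (v - 1) (honestPoly I c i) - κ.share i (v - 1)

/-- The contribution of the node `v` to check `i`, without the mask. -/
def honestForm (v : Fin n) : ZMod q :=
  checkForm (evalPoint c) i
    (nodePoly d v (fun j => κ.share j v) fun j => honestRight I κ c j v)

/-- The sums over the subtrees in the masked check `i`. -/
def honestSum : Fin n → ZMod q :=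
  update (κ.sum i) 0 (checkTarget N I.target (I.oracle (evalPoint c)) i)

/-- The masks for check `i`. -/
def honestMask : Fin n → ZMod q :=
  treeMatrix (ZMod q) I.parent *ᵥ honestSum I κ c i - honestForm I κ c i

/-- The sums of the masks for check `i` over the subtrees. -/
def honestMaskSum : Fin n → ZMod q :=
  (treeMatrix (ZMod q) I.parent)⁻¹ *ᵥ honestMask I κ c i

/-- The commitments of the honest prover at the node `v`. -/
def honestCommit (v : Fin n) (i : Fin (N + 1)) : Commit (ZMod q) (slots n d) t where
  left := κ.share i v
  right := honestRight I κ c i v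
  mask := honestMask I κ c i v
  blind l := (treeMatrix (ZMod q) I.parent *ᵥ update (κ.blind i l) 0 0) v

/-- The values that the honest prover reveals to the node `v`. -/
def honestReveal (v : Fin n) (i : Fin (N + 1)) : Reveal (ZMod q) t where
  chal := c i
  sum := honestSum I κ c i v
  test l := (update (κ.blind i l) 0 0 + (c i).2 l • honestMaskSum I κ c i) v

section Dependence

theorem dependsOn_honestRight (v : Fin n) :
    DependsOn (fun c => honestRight I κ c i v) (Set.Iio i) := by
  intro c c' h
  suffices honestPoly I c i = honestPoly I c' i by simp only [honestRight, this]
  cases i using Fin.lastCases with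
  | last => simp [honestPoly]
  | cast i =>
    have hpoly : roundPoly I.poly (evalPoint c) i = roundPoly I.poly (evalPoint c') i :=
      dependsOn_roundPoly I.poly i fun j hj =>
        congrArg Prod.fst (h j.castSucc (Fin.castSucc_lt_castSucc_iff.2 hj))
    simpa [honestPoly] using hpoly

theorem dependsOn_honestForm : DependsOn (fun c => honestForm I κ c i) (Set.Iio i) := by
  refine fun c c' h => funext fun v => checkForm_congr (fun j hj => congrArg Prod.fst (h _ hj))
    fun j hj => ?_
  have hright : honestRight I κ c j.castSucc v = honestRight I κ c' j.castSucc v :=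
    dependsOn_honestRight I κ _ v fun k hk => h k (hk.trans_le hj)
  simp only [nodePoly, hright]

theorem dependsOn_honestSum : DependsOn (fun c => honestSum I κ c i) (Set.Iio i) := by
  intro c c' h
  suffices checkTarget N I.target (I.oracle (evalPoint c)) i =
      checkTarget N I.target (I.oracle (evalPoint c')) i by
    simp only [honestSum, this]
  rcases eq_or_ne i (Fin.last N) with rfl | hi
  · have hpoint : evalPoint c = evalPoint c' :=
      funext fun j => congrArg Prod.fst (h j.castSucc (Fin.castSucc_lt_last j))
    rw [hpoint]
  · simp [checkTarget, hi]

theorem dependsOn_honestMask : DependsOn (fun c => honestMask I κ c i) (Set.Iio i) := by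
  intro c c' h
  have hsum : honestSum I κ c i = honestSum I κ c' i := dependsOn_honestSum I κ i h
  have hform : honestForm I κ c i = honestForm I κ c' i := dependsOn_honestForm I κ i h
  simp only [honestMask, hsum, hform]

theorem dependsOn_honestCommit (v : Fin n) :
    DependsOn (fun c => honestCommit I κ c v i) (Set.Iio i) := by
  intro c c' h
  have hright : honestRight I κ c i v = honestRight I κ c' i v := dependsOn_honestRight I κ i v h
  have hmask : honestMask I κ c i = honestMask I κ c' i := dependsOn_honestMask I κ i h
  simp only [honestCommit, hright, hmask]

theorem dependsOn_honestReveal (v : Fin n) :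
    DependsOn (fun c => honestReveal I κ c v i) (Set.Iic i) := by
  intro c c' h
  have hlt : ∀ j ∈ Set.Iio i, c j = c' j := fun j hj => h j (Set.Iio_subset_Iic_self hj)
  have hmask : honestMask I κ c i = honestMask I κ c' i := dependsOn_honestMask I κ i hlt
  have hsum : honestSum I κ c i = honestSum I κ c' i := dependsOn_honestSum I κ i hlt
  have hi : c i = c' i := h i Set.self_mem_Iic
  simp only [honestReveal, honestMaskSum, hmask, hsum, hi]

end Dependence

section Check

theorem treeMatrix_mulVec_honestMaskSum :
    treeMatrix (ZMod q) I.parent *ᵥ honestMaskSum I κ c i = honestMask I κ c i := by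
  have hunit := (isUnit_iff_isUnit_det _).1 (I.isRootedTree.isUnit_treeMatrix (K := ZMod q))
  rw [honestMaskSum, mulVec_mulVec, mul_nonsing_inv _ hunit, one_mulVec]

variable {I}

theorem honestMaskSum_root (hI : I.Claim) : honestMaskSum I κ c i 0 = 0 := by
  have hform : ∑ v, honestForm I κ c i v = checkTarget N I.target (I.oracle (evalPoint c)) i := by
    have hpoly : ∑ v, nodePoly d v (fun j => κ.share j v) (fun j => honestRight I κ c j v) =
        roundPoly I.poly (evalPoint c) := by
      funext j
      rw [Finset.sum_apply, ← sum_sharePoly (natDegree_roundPoly_le _ I.degreeOf_le _ j)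
        (lt_slots_mul n d) (κ.share j.castSucc)]
      simp only [nodePoly, honestRight, honestPoly, Fin.snoc_castSucc]
    have htarget : _ = I.target := hI
    simp only [honestForm, ← map_sum, hpoly, checkForm_roundPoly]
    rw [← htarget]
    rfl
  rw [← I.isRootedTree.sum_treeMatrix_mulVec (honestMaskSum I κ c i),
    treeMatrix_mulVec_honestMaskSum]
  simp only [honestMask, Pi.sub_apply, Finset.sum_sub_distrib, hform,
    I.isRootedTree.sum_treeMatrix_mulVec]
  simp [honestSum]

theorem honest_nodeCheck (hI : I.Claim) (c : Fin n → Fin (N + 1) → Challenge (ZMod q) t)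
    (v : Fin n) :
    NodeCheck d v I.target ((rootAnswer I v (c 0)).getD 0) (c v) (honestCommit I κ (c 0) v)
      (honestReveal I κ (c 0) v) (childData I.parent (honestReveal I κ (c 0)) v) where
  root_chal hv i := by rw [hv]; rfl
  root_sum hv i := by simp [hv, honestReveal, honestSum, rootAnswer]
  root_test hv i := funext fun l => by simp [hv, honestReveal, honestMaskSum_root κ (c 0) i hI]
  kid_chal u r hr i := by
    unfold childData at hr
    split_ifs at hr
    cases hr
    rfl
  sum_eq i := by
    have h := treeMatrix_mulVec_eq_sub_sum_childData (parent := I.parent)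
      (honestReveal I κ (c 0)) (fun r => (r i).sum) v
    have hmask : (honestCommit I κ (c 0) v i).mask =
        (treeMatrix (ZMod q) I.parent *ᵥ honestSum I κ (c 0) i) v - honestForm I κ (c 0) i v := rfl
    linear_combination (norm := skip) -h - hmask
    simp only [honestReveal, honestForm, honestCommit]
    ring
  test_eq i l := by
    have h := treeMatrix_mulVec_eq_sub_sum_childData (parent := I.parent)
      (honestReveal I κ (c 0)) (fun r => (r i).test l) v
    have hsplit : (treeMatrix (ZMod q) I.parent *ᵥ
        fun u => (honestReveal I κ (c 0) u i).test l) v =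
          (honestCommit I κ (c 0) v i).blind l +
            (c 0 i).2 l * (honestCommit I κ (c 0) v i).mask := by
      have hadd := congrFun (mulVec_add (treeMatrix (ZMod q) I.parent) (update (κ.blind i l) 0 0)
        ((c 0 i).2 l • honestMaskSum I κ (c 0) i)) v
      rwa [mulVec_smul, treeMatrix_mulVec_honestMaskSum] at hadd
    have hchal : (honestReveal I κ (c 0) v i).chal = c 0 i := rfl
    rw [hchal]
    linear_combination hsplit - h

end Check

theorem dependsOn_phaseMsg_honest (v : Fin n) (k : Fin (N + 2)) :
    DependsOn (fun c => phaseMsg (honestCommit I κ c v) (honestReveal I κ c v) k)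
      {j | j.castSucc < k} := by
  refine fun c c' h => Prod.ext ?_ ?_
  · cases k using Fin.lastCases with
    | last => simp [phaseMsg]
    | cast i => simpa [phaseMsg] using dependsOn_honestCommit I κ i v fun j hj => h j hj
  · cases k using Fin.cases with
    | zero => simp [phaseMsg]
    | succ i =>
      simpa [phaseMsg] using dependsOn_honestReveal I κ i v fun j hj =>
        h j (Fin.castSucc_lt_succ_iff.2 hj)

/-- The challenges of the root in the list of all messages between the prover and the nodes. -/
def challengeOf (τ : List (Fin n → Msg (proverBits n d t q))) (i : Fin (N + 1)) :
    Challenge (ZMod q) t :=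
  decode (τ.getD (2 * i + 1) default 0)

variable (t) in
/-- The honest prover. In a phase the challenges to come decode to arbitrary values, on which its
message does not depend. -/
def honestProver : Prover n (proverBits n d t q) where
  Coin := ProverCoin (ZMod q) n N (slots n d) t
  msg κ τ v := encode _ (phaseMsg (honestCommit I κ (challengeOf τ) v)
    (honestReveal I κ (challengeOf τ) v) (Fin.ofNat (N + 2) (τ.length / 2)))

theorem challengeOf_transcript {P : Prover n (proverBits n d t q)}
    (ω : (protocol n N d t q).Coins P) {k : ℕ} {i : Fin (N + 1)} (hi : 2 * (i : ℕ) + 1 < k) :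
    challengeOf ((protocol n N d t q).transcript P I ω k) i = ω.1 0 i := by
  have hround : challengeOf ((protocol n N d t q).transcript P I ω k) i =
      (decode ((protocol n N d t q).roundMsg P I ω (2 * i + 1) 0) : Challenge (ZMod q) t) := by
    simp [challengeOf, DIP.transcript_eq_map_roundMsg, hi]
  rw [hround, roundMsg_node, decode_encode card_challenge_le]

theorem honest_nodeTranscript (ω : (protocol n N d t q).Coins (honestProver t I)) (v : Fin n) :
    (protocol n N d t q).nodeTranscript (honestProver t I) I ω v =
      transcriptOf (ω.1 v)
        (phaseMsg (honestCommit I ω.2.2 (ω.1 0) v) (honestReveal I ω.2.2 (ω.1 0) v)) := by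
  rw [DIP.nodeTranscript_eq_map_roundMsg]
  refine List.map_congr_left fun j hj => ?_
  rw [List.mem_range] at hj
  rcases Nat.even_or_odd' j with ⟨i, rfl | rfl⟩
  · have hi : (Fin.ofNat (N + 2) i : ℕ) = i := Nat.mod_eq_of_lt (by lia)
    have hround := roundMsg_prover (honestProver t I) I ω (Fin.ofNat (N + 2) i)
    have hphase := dependsOn_phaseMsg_honest I ω.2.2 v (Fin.ofNat (N + 2) i)
      (x := challengeOf ((protocol n N d t q).transcript (honestProver t I) I ω (2 * i)))
      (y := ω.1 0) fun j hj => challengeOf_transcript I ω (by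
        have hji : (j : ℕ) < i := hi ▸ hj
        lia)
    have hlen :
        ((protocol n N d t q).transcript (honestProver t I) I ω (2 * i)).length / 2 = i := by
      rw [DIP.transcript_eq_map_roundMsg, List.length_map, List.length_range]
      lia
    rw [hi] at hround
    rw [hround, if_pos (even_two_mul i), show 2 * i / 2 = i by lia]
    refine congrArg (encode _) (Eq.trans ?_ hphase)
    simp only [hlen]
  · have hi : (Fin.ofNat (N + 1) i : ℕ) = i := Nat.mod_eq_of_lt (by lia)
    have hround := roundMsg_node (honestProver t I) I ω (Fin.ofNat (N + 1) i)
    rw [hi] at hround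
    rw [hround, if_neg (by grind), show (2 * i + 1) / 2 = i by lia]

theorem honest_acceptProb {I : SumcheckInstance n N d q} (hI : I.Claim) :
    (protocol n N d t q).acceptProb (honestProver t I) I = 1 := by
  refine (congrArg prob (Set.eq_univ_of_forall fun ω => (accepts_iff _ I ω).2 fun v => ?_)).trans
    prob_univ
  simp only [honest_nodeTranscript, commitOf_transcriptOf, revealOf_transcriptOf]
  exact honest_nodeCheck ω.2.2 hI ω.1 v

end Honest

/-! ### Simulation -/

section Simulation

/-- The coins of an execution with the honest prover, all of which every node of the simulator
samples on its own. -/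
abbrev SimCoin (n N d t q : ℕ) : Type :=
  (Fin n → Fin (N + 1) → Challenge (ZMod q) t) × (Fin n → Unit) ×
    ProverCoin (ZMod q) n N (slots n d) t

variable {n N d t q : ℕ} [NeZero n] [Fact q.Prime]

/-- The simulated message that reveals the sums of the node `u`: they are uniform except for
those of the root, which are what its test requires for the claimed sum `a` and the answer `b` of
the oracle. -/
def simReveal (a b : ZMod q) (ω : SimCoin n N d t q) (u : Fin n) (i : Fin (N + 1)) :
    Reveal (ZMod q) t where
  chal := ω.1 0 i
  sum := update (ω.2.2.sum i) 0 (checkTarget N a b i) u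
  test l := update (ω.2.2.blind i l) 0 0 u

/-- The simulated view of the node with the local input `x`, the answer `ans` from the oracle and
the children `isKid`: shares and revealed sums are sampled, and the rest of the commitment is what
lets the node accept. -/
def simulatedView (x : LocalInput n q) (ω : SimCoin n N d t q) (ans : Option (ZMod q))
    (isKid : Fin n → Bool) : NodeView (protocol n N d t q) :=
  let reveal := simReveal x.target (ans.getD 0) ω
  let kidReveal (u : Fin n) : NodeMsg N t q := if isKid u then some (reveal u) else none
  let commit := solveCommit d x.id (fun i => ω.2.2.share i x.id) (fun i => ω.2.2.share i (x.id - 1))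
    (reveal x.id) kidReveal
  { coin := ω.1 x.id
    proverMsgs := transcriptOf (ω.1 x.id) (phaseMsg commit (reveal x.id))
    verifierCoin := ()
    received := receivedHist ans x.nbrs kidReveal }

variable (n N d t q) in
/-- The simulator: every node tells its neighbours whether they are its parent, the root queries
the oracle at a random point, and each node outputs a simulated view. -/
def simulator : Simulator (protocol n N d t q) :=
  oneRoundAlg (B := 1) (Coin := SimCoin n N d t q) (fun x => x.id) (fun _ ω => evalPoint (ω.1 0))
    (fun x u _ => decide (x.parent = some u))
    fun x ω h => simulatedView x ω (h.answers.getD 0 none)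
      fun u => (h.inbox.getD 0 (fun _ => none) u).elim false (· 0)

variable (I : SumcheckInstance n N d q) (v : Fin n)

theorem simQueryCount_simulator (c : Fin n → (simulator n N d t q).Coin) :
    DIP.simQueryCount (simulator n N d t q) I c = 1 :=
  queryCount_oneRoundAlg _ _ (fun _ => rfl) _

theorem simView_simulator (c : Fin n → SimCoin n N d t q) :
    DIP.simView (simulator n N d t q) I v c =
      simulatedView (I.localInput v) (c v) (rootAnswer I v ((c v).1 0))
        fun u => decide (I.parent u = some v) := by
  unfold DIP.simView DistAlg.out simulator
  rw [finalHist_oneRoundAlg _ _ fun _ => rfl]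
  refine congrArg₂ (simulatedView _ _) ?_ (funext fun u => ?_)
  · by_cases hv : v = 0 <;> simp [rootAnswer, hv]
  · classical
    change (if I.graph.Adj u v then some fun _ => decide (I.parent u = some v) else none :
      Option (Msg 1)).elim false (· 0) = decide (I.parent u = some v)
    have hadj := I.parent_adj u v
    by_cases hu : I.graph.Adj u v <;> simp_all

/-- The change of coins that turns the view of the node `v` with the honest prover into
the simulated one: the share of its predecessor is replaced by the complementary one, and the
blinding values by the values of the tests. -/
def recoin (ω : SimCoin n N d t q) : SimCoin n N d t q :=
  (ω.1, ω.2.1,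
    { share := fun i => update (ω.2.2.share i) (v - 1) (honestRight I ω.2.2 (ω.1 0) i v)
      sum := ω.2.2.sum
      blind := fun i l => ω.2.2.blind i l + (ω.1 0 i).2 l • honestMaskSum I ω.2.2 (ω.1 0) i })

theorem recoin_bijective : Bijective (recoin (t := t) I v) := by
  refine Finite.injective_iff_bijective.1 ?_
  rintro ⟨c, y, κ⟩ ⟨c', y', κ'⟩ h
  obtain ⟨rfl, rfl, hκ⟩ : c = c' ∧ y = y' ∧ _ := by simpa only [recoin, Prod.mk.injEq] using h
  obtain ⟨hshare, hsum, hblind⟩ := ProverCoin.mk.inj hκ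
  have hshare : κ.share = κ'.share := by
    funext i u
    have hi := congrFun hshare i
    rcases eq_or_ne u (v - 1) with rfl | hu
    · simpa [honestRight] using congrFun hi (v - 1)
    · simpa [hu] using congrFun hi u
  have hmask : honestMaskSum I κ (c 0) = honestMaskSum I κ' (c 0) := by
    unfold honestMaskSum honestMask honestForm honestRight honestSum
    rw [hshare, hsum]
  have hblind : κ.blind = κ'.blind :=
    funext₂ fun i l => add_right_cancel ((congrFun₂ hblind i l).trans (by rw [hmask]))
  rw [ProverCoin.ext hshare hsum hblind]

variable {I}

theorem simReveal_recoin (hI : I.Claim) (ω : SimCoin n N d t q) {b : ZMod q} {u : Fin n}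
    (hb : u = 0 → b = I.oracle (evalPoint (ω.1 0))) :
    simReveal I.target b (recoin I v ω) u = honestReveal I ω.2.2 (ω.1 0) u := by
  funext i
  rcases eq_or_ne u 0 with rfl | hu
  · simp [simReveal, recoin, honestReveal, honestSum, hb, honestMaskSum_root _ _ _ hI]
  · simp [simReveal, recoin, honestReveal, honestSum, hu]

theorem view_honestProver (hn : 2 ≤ n) (hI : I.Claim)
    (ω : (protocol n N d t q).Coins (honestProver t I)) :
    (protocol n N d t q).view (honestProver t I) I v ω =
      simulatedView (I.localInput v) (recoin I v ω) (rootAnswer I v (ω.1 0))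
        fun u => decide (I.parent u = some v) := by
  have hv : v ≠ v - 1 := by
    rw [ne_comm, Ne, sub_eq_self, Fin.one_eq_zero_iff]
    lia
  have hreveal : simReveal I.target ((rootAnswer I v (ω.1 0)).getD 0) (recoin I v ω) v =
      honestReveal I ω.2.2 (ω.1 0) v :=
    simReveal_recoin v hI ω fun hv => by simp [rootAnswer, hv]
  have hkids : childData I.parent (honestReveal I ω.2.2 (ω.1 0)) v = fun u =>
      if decide (I.parent u = some v) then
        some (simReveal I.target ((rootAnswer I v (ω.1 0)).getD 0) (recoin I v ω) u) else none := by
    funext u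
    refine if_ctx_congr decide_eq_true_iff.symm (fun hu => ?_) fun _ => rfl
    have hu0 : u ≠ 0 := (I.parent_eq_none_iff u).not.1 (by simp [of_decide_eq_true hu])
    rw [simReveal_recoin v hI ω fun h => absurd h hu0]
  have hcommit := (honest_nodeCheck ω.2.2 hI ω.1 v).commit_eq
  have hleft : (fun i => (honestCommit I ω.2.2 (ω.1 0) v i).left) =
      fun i => (recoin I v ω).2.2.share i v := by
    simp [recoin, honestCommit, hv]
  have hright : (fun i => (honestCommit I ω.2.2 (ω.1 0) v i).right) =
      fun i => (recoin I v ω).2.2.share i (v - 1) := by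
    simp [recoin, honestCommit]
  rw [hleft, hright, hkids, ← hreveal] at hcommit
  unfold DIP.view
  rw [finalHist_verification]
  simp only [honest_nodeTranscript, revealOf_transcriptOf]
  rw [hcommit, hkids, ← hreveal]
  rfl

theorem tvDist_simView_view (hn : 2 ≤ n) (hI : I.Claim) :
    tvDist (DIP.simView (simulator n N d t q) I v)
      ((protocol n N d t q).view (honestProver t I) I v) = 0 := by
  let ideal (ω : SimCoin n N d t q) : NodeView (protocol n N d t q) :=
    simulatedView (I.localInput v) ω (rootAnswer I v (ω.1 0))
      fun u => decide (I.parent u = some v)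
  have hsim : DIP.simView (simulator n N d t q) I v = ideal ∘ Function.eval v :=
    funext (simView_simulator I v)
  have hview : (protocol n N d t q).view (honestProver t I) I v = ideal ∘ recoin I v :=
    funext (view_honestProver v hn hI)
  refine tvDist_eq_zero fun A => ?_
  rw [hsim, hview]
  exact (prob_preimage_eval v (ideal ⁻¹' A)).trans
    (prob_preimage_of_bijective (recoin_bijective I v) (ideal ⁻¹' A)).symm

end Simulation

section SimError

/-- The simulation error: a single node is its own cyclic predecessor and so holds both shares of
all coefficients, which the simulator cannot produce; with more nodes the simulation is perfect. -/
def simError (n : ℕ) : ℝ := if n ≤ 1 then 1 else 0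

theorem superpolynomialDecay_simError :
    Asymptotics.SuperpolynomialDecay Filter.atTop (fun n : ℕ => (n : ℝ)) simError := by
  intro k
  refine tendsto_const_nhds.congr' ?_
  filter_upwards [Filter.eventually_gt_atTop 1] with n hn
  rw [simError, if_neg hn.not_ge, mul_zero]

theorem tvDist_simView_view_le {n N d t q : ℕ} [NeZero n] [Fact q.Prime]
    {I : SumcheckInstance n N d q} (hI : I.Claim) (v : Fin n) :
    tvDist (DIP.simView (simulator n N d t q) I v)
      ((protocol n N d t q).view (honestProver t I) I v) ≤ simError n := by
  unfold simError
  split_ifs with hn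
  · exact tvDist_le_one _ _
  · exact (tvDist_simView_view v (not_le.1 hn) hI).le

end SimError

/-! ### Message sizes -/

section Sizes

variable {n N d t q C : ℕ}

theorem one_le_log (hq : q.Prime) : 1 ≤ Nat.log 2 q := Nat.log_pos one_lt_two hq.two_le

theorem width_le (hq : q.Prime) : width q ≤ 2 * Nat.log 2 q := by
  have := one_le_log hq
  lia

theorem proverBits_le (hq : q.Prime) (hd : d ≤ C * n) :
    proverBits n d t q ≤ (4 * C + 6 * t + 10) * Nat.log 2 q :=
  calc proverBits n d t q ≤ (2 * C + 3 * t + 5) * (2 * Nat.log 2 q) := by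
        have hslots : d / n ≤ C := Nat.div_le_of_le_mul (by rwa [mul_comm])
        exact Nat.mul_le_mul (by lia) (width_le hq)
    _ = (4 * C + 6 * t + 10) * Nat.log 2 q := by ring

theorem nodeBits_le (hq : q.Prime) (hN : 0 < N) :
    nodeBits N t q ≤ (8 * t + 9) * (N * Nat.log 2 q) :=
  calc nodeBits N t q ≤ (2 * t + 2) * (2 * N) * (2 * Nat.log 2 q) + N * Nat.log 2 q :=
        Nat.add_le_add (Nat.mul_le_mul (Nat.mul_le_mul_left _ (by lia)) (width_le hq))
          (Nat.mul_pos hN (one_le_log hq))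
    _ = (8 * t + 9) * (N * Nat.log 2 q) := by ring

end Sizes

end

end DistSumcheck

theorem theorem1 :
    ∃ (proto : ∀ (n N d t q : ℕ) [NeZero n] [Fact q.Prime], DIP n N q)
      (sim : ∀ (n N d t q : ℕ) [NeZero n] [Fact q.Prime], Simulator (proto n N d t q))
      (honest : ∀ (n N d t q : ℕ) [NeZero n] [Fact q.Prime],
        SumcheckInstance n N d q → Prover n (proto n N d t q).bits)
      (ε : ℕ → ℝ) (c : ℕ),
      -- `ε` is negligible in the number of nodes
      Asymptotics.SuperpolynomialDecay Filter.atTop (fun n : ℕ => (n : ℝ)) ε ∧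
      (∀ (n N d t q : ℕ) [NeZero n] [Fact q.Prime], 0 < N → 0 < t →
        -- numbers of rounds
        (proto n N d t q).rounds ≤ c * N ∧
        (proto n N d t q).verifier.rounds ≤ c ∧
        (sim n N d t q).rounds ≤ c ∧
        ∀ I : SumcheckInstance n N d q,
          -- perfect completeness and statistical zero-knowledge
          (I.Claim →
            (proto n N d t q).acceptProb (honest n N d t q I) I = 1 ∧
            ∀ v : Fin n,
              tvDist (DIP.simView (sim n N d t q) I v)
                ((proto n N d t q).view (honest n N d t q I) I v) ≤ ε n) ∧
          -- soundness
          (¬ I.Claim → ∀ P : Prover n (proto n N d t q).bits,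
            (proto n N d t q).acceptProb P I ≤ (N : ℝ) * d / q + 1 / t) ∧
          -- a single oracle query
          (∀ (P : Prover n (proto n N d t q).bits) (ω : (proto n N d t q).Coins P),
            (proto n N d t q).queryCount P I ω ≤ 1) ∧
          (∀ ω : Fin n → (sim n N d t q).Coin, DIP.simQueryCount (sim n N d t q) I ω ≤ 1)) ∧
      -- message sizes, for fixed `t` and individual degree `d = O(n)`
      (∀ t C : ℕ, 0 < t → ∃ K : ℕ, ∀ (n N d q : ℕ) [NeZero n] [Fact q.Prime],
        0 < N → d ≤ C * n →
          (proto n N d t q).bits ≤ K * Nat.log 2 q ∧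
          (proto n N d t q).verifier.bits ≤ K * (N * Nat.log 2 q) ∧
          (sim n N d t q).bits ≤ K * (N * Nat.log 2 q)) := by
  refine ⟨fun n N d t q _ _ => protocol n N d t q, fun n N d t q _ _ => simulator n N d t q,
    fun _ _ _ t _ _ _ I => honestProver t I, simError, 5, superpolynomialDecay_simError, ?_, ?_⟩
  · intro n N d t q _ _ hN ht
    have hrounds : 2 * N + 3 ≤ 5 * N := by lia
    exact ⟨hrounds, Nat.le_add_left 1 4, Nat.le_add_left 1 4, fun I =>
      ⟨fun hI => ⟨honest_acceptProb hI, tvDist_simView_view_le hI⟩,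
        fun hI P => protocol_soundness P I ht hI, fun P ω => (queryCount_protocol P I ω).le,
        fun ω => (simQueryCount_simulator I ω).le⟩⟩
  · intro t C _
    refine ⟨(4 * C + 6 * t + 10) + (8 * t + 9), fun n N d q _ hq hN hd => ⟨?_, ?_, ?_⟩⟩
    · exact (proverBits_le hq.out hd).trans (Nat.mul_le_mul_right _ (Nat.le_add_right _ _))
    · exact (nodeBits_le hq.out hN).trans (Nat.mul_le_mul_right _ (Nat.le_add_left _ _))
    · exact Nat.mul_pos (Nat.succ_pos _) (Nat.mul_pos hN (one_le_log hq.out))
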